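/- Let $P=\mathbb{C}[x_0,\dots,x_n]$ and $[n]=\{0,\dots,n\}$. A simplicial complex $X$ is a family of subsets of $[n]$ closed under taking subsets; $[X]=\{v : \{v\}\in X\}$ is its vertex set. For $p\subseteq[n]$ write $x^p=\prod_{i\in p}x_i$ and identify $p$ with its characteristic vector in $\{0,1\}^{n+1}$. Let $I_X=\langle x^p : p\subseteq[n],\ p\notin X\rangle$ and let $A_X=P/I_X$ be the Stanley–Reisner ring. Let $T^1(X)$ be the cokernel of the natural map $\mathrm{Der}_{\mathbb{C}}(P,P)\to\mathrm{Hom}_P(I_X,A_X)$. Let $F=\bigoplus_{p\notin X}P\,e_p$, let $j:F\to P$, $e_p\mapsto x^p$, let $R=\ker j$, and let $R_0\subseteq R$ be the submodule spanned by the Koszul relations $j(f)e-j(e)f$ with $e,f\in F$. Let $T^2(X)$ be the cokernel of the restriction map $\mathrm{Hom}_P(F,A_X)\to\mathrm{Hom}_{A_X}(R/R_0,A_X)$. With $\deg e_p=p$ all these modules are $\mathbb{Z}^{n+1}$-graded; $T^i_{\mathbf c}(X)$ denotes the homogeneous summand of $T^i(X)$ of degree $\mathbf c$. For disjoint $a,b\subseteq[n]$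 put $$N_{a-b}(X)=\{f\in X : a\subseteq f,\ f\cap b=\emptyset,\ f\cup b\notin X\},$$ $$\widetilde N_{a-b}(X)=\{f\in N_{a-b}(X) : f\cup b'\notin X\text{ for some } b'\subsetneq b\},$$ and for $a \in X$ let $\mathrm{lk}(a)=\{g\in X : g\cap a=\emptyset,\ g\cup a\in X\}$, again regarded as a simplicial complex on $[n]$. For $\mathbf a\in\mathbb{N}^{n+1}$ with support $a$ and $b\subseteq[n]$ disjoint from $a$, say that $\lambda:N_{a-b}(X)\to\mathbb{C}$ represents $t\in T^1_{\mathbf a-b}(X)$ if $t$ is the class of some $\varphi\in\mathrm{Hom}_P(I_X,A_X)$ of degree $\mathbf a-b$ with $\varphi(x^p)=\lambda(f)\,x^{p+\mathbf a-b}$ whenever $p\notin X$ and $f=(p\cup a)\setminus b\in N_{a-b}(X)$. Say that a $\mathbb{C}$-valued function $\lambda$ on the pairs $(f,g)\in N_{a-b}(X)^2$ with $f\cup g\in X$ represents $t\in T^2_{\mathbf a-b}(X)$ if $t$ is the class of some $\psi\in\mathrm{Hom}_{A_X}(R/R_0,A_X)$ of degree $\mathbf a-b$ such that, for all $p,q\notin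 X$ for which $f=(p\cup a)\setminus b$ and $g=(q\cup a)\setminus b$ lie in $N_{a-b}(X)$ and $f\cup g\in X$, $$\psi(x^{q\setminus p}e_p-x^{p\setminus q}e_q)=\lambda(f,g)\,x^{(p\cup q)+\mathbf a-b}.$$ Here a monomial with a negative exponent is read as $0$. **Proposition.** (1) Let $\mathbf c=\mathbf a-\mathbf b$ with $\mathbf a,\mathbf b\in\mathbb{N}^{n+1}$ having disjoint supports $a,b$. Then $T^i_{\mathbf c}(X)=0$ for $i=1,2$ unless $a\in X$ and $b\subseteq[\mathrm{lk}(a)]$. (2) Let $\mathbf a\in\mathbb{N}^{n+1}$ have support $a\in X$, and let $b\subseteq[\mathrm{lk}(a)]$ be disjoint from $a$. Then $f\mapsto f\setminus a$ is a bijection $N_{a-b}(X)\to N_{\emptyset-b}(\mathrm{lk}(a))$, and $f\in\widetilde N_{a-b}(X)$ if and only if $f\setminus a\in\widetilde N_{\emptyset-b}(\mathrm{lk}(a))$. For $i=1,2$ this bijection induces a $\mathbb{C}$-linear isomorphism $T^i_{\emptyset-b}(\mathrm{lk}(a))\cong T^i_{\mathbf a-b}(X)$ in the following sense: every class in $T^i_{\emptyset-b}(\mathrm{lk}(a))$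 is represented by some function $\lambda$, and $\lambda$ represents a class $t$ if and only if its pullback along $f\mapsto f\setminus a$ represents the image of $t$. -/

import Mathlib

noncomputable section

namespace StanleyReisner

open MvPolynomial

/-! ### Simplicial complexes and the sets `N` and `Ñ` -/

/-- A simplicial complex on (a subset of) `V`: a family of finite subsets of `V` that is closed
under taking subsets. So `∅` is a face as soon as there is any face (the family without faces is
allowed, too), and not every element of `V` has to be a vertex. -/
structure Complex (V : Type*) where
  faces : Set (Finset V)
  down_closed : ∀ ⦃f g : Finset V⦄, f ∈ faces → g ⊆ f → g ∈ faces

variable {V : Type*}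

instance : Membership (Finset V) (Complex V) := ⟨fun X f => f ∈ X.faces⟩

/-- The vertex set `[X]`. -/
def Complex.vertices (X : Complex V) : Set V := {v | ({v} : Finset V) ∈ X}

variable [DecidableEq V]

/-- The link of `a` in `X`. -/
def Complex.link (X : Complex V) (a : Finset V) : Complex V where
  faces := {g | g ∈ X ∧ Disjoint g a ∧ g ∪ a ∈ X}
  down_closed := fun _ _ hf hgf =>
    ⟨X.down_closed hf.1 hgf, hf.2.1.mono_left hgf,
      X.down_closed hf.2.2 (Finset.union_subset_union_left hgf)⟩

/-- `N_{a-b}(X) = {f ∈ X | a ⊆ f, f ∩ b = ∅, f ∪ b ∉ X}`. -/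
def nSet (X : Complex V) (a b : Finset V) : Set (Finset V) :=
  {f | f ∈ X ∧ a ⊆ f ∧ f ∩ b = ∅ ∧ f ∪ b ∉ X}

/-- `Ñ_{a-b}(X)`: those `f ∈ N_{a-b}(X)` with `f ∪ b' ∉ X` for some proper subset `b'` of `b`. -/
def nTilde (X : Complex V) (a b : Finset V) : Set (Finset V) :=
  {f | f ∈ nSet X a b ∧ ∃ b' : Finset V, b' ⊂ b ∧ f ∪ b' ∉ X}

/-! ### Cotangent cohomology of a quotient of a polynomial ring `P` -/

section Cotangent

variable {P : Type*} [CommRing P] [Algebra ℂ P]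

/-- The natural map `Der_ℂ(P, P) → Hom_P(I, P/I)`, `D ↦ (f ↦ D f mod I)`. -/
def derToHom (I : Ideal P) : Derivation ℂ P P →ₗ[P] (I →ₗ[P] (P ⧸ I)) where
  toFun D :=
    { toFun := fun f => Ideal.Quotient.mk I (D f)
      map_add' := fun f g => by simp
      map_smul' := fun r f => by
        have h : Ideal.Quotient.mk I ((f : P) * D r) = 0 :=
          Ideal.Quotient.eq_zero_iff_mem.2 (I.mul_mem_right _ f.2)
        simp only [Submodule.coe_smul, smul_eq_mul, Derivation.leibniz, map_add, h, add_zero,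
          RingHom.id_apply]
        rfl }
  map_add' D E := by ext f; simp
  map_smul' r D := by ext f; rfl

/-- `T¹` of `A = P/I`, for a polynomial ring `P` over `ℂ`: the cokernel of
`Der_ℂ(P, P) → Hom_P(I, A)`. -/
abbrev TOne (I : Ideal P) : Type _ :=
  (I →ₗ[P] (P ⧸ I)) ⧸ LinearMap.range (derToHom I)

end Cotangent

section Presentation

variable {P : Type*} [CommRing P] {ι : Type*} (g : ι → P)

/-- The ideal generated by the `g p`. -/
abbrev genIdeal : Ideal P := Ideal.span (Set.range g)

variable [Fintype ι]

/-- The map `j : P^ι → P`, `e_p ↦ g p`. Its image is the ideal generated by the `g p`. -/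
abbrev genMap : (ι → P) →ₗ[P] P := Fintype.linearCombination P g

/-- The module `R = ker j` of relations. -/
abbrev relations : Submodule P (ι → P) := LinearMap.ker (genMap g)

/-- The submodule `R₀ ⊆ R` of Koszul relations, spanned by the `j(f) e - j(e) f`. -/
def koszul : Submodule P (relations g) :=
  Submodule.span P {r | ∃ e f : ι → P, (r : ι → P) = genMap g f • e - genMap g e • f}

/-- `Hom_A(R/R₀, A)` for `A = P/I`. As `P → A` is surjective, the `A`-linear maps between the
`A`-modules `R/R₀` and `A` are the `P`-linear ones. -/
abbrev RelHom : Type _ := (relations g ⧸ koszul g) →ₗ[P] (P ⧸ genIdeal g)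

/-- A homomorphism `P^ι → A` vanishes on the Koszul relations. -/
lemma koszul_le_ker (u : (ι → P) →ₗ[P] (P ⧸ genIdeal g)) :
    koszul g ≤ LinearMap.ker (u ∘ₗ (relations g).subtype) := by
  have key : ∀ (e : ι → P) (y : P ⧸ genIdeal g), genMap g e • y = 0 := by
    intro e y
    have he : genMap g e ∈ genIdeal g := by
      rw [genIdeal, Ideal.span, ← Fintype.range_linearCombination]
      exact ⟨e, rfl⟩
    obtain ⟨y, rfl⟩ := Ideal.Quotient.mk_surjective y
    exact Ideal.Quotient.eq_zero_iff_mem.2 ((genIdeal g).mul_mem_right y he)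
  refine Submodule.span_le.2 ?_
  rintro r ⟨e, f, hr⟩
  simp only [SetLike.mem_coe, LinearMap.mem_ker, LinearMap.comp_apply, Submodule.subtype_apply, hr,
    map_sub, map_smul, key, sub_zero]

/-- The natural map `Hom_P(P^ι, A) → Hom_A(R/R₀, A)` given by restriction to `R`. -/
def restrictHom : ((ι → P) →ₗ[P] (P ⧸ genIdeal g)) →ₗ[P] RelHom g where
  toFun u := (koszul g).liftQ (u ∘ₗ (relations g).subtype) (koszul_le_ker g u)
  map_add' u v := by
    refine LinearMap.ext fun r => ?_
    obtain ⟨r, rfl⟩ := Submodule.Quotient.mk_surjective _ r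
    rfl
  map_smul' c u := by
    refine LinearMap.ext fun r => ?_
    obtain ⟨r, rfl⟩ := Submodule.Quotient.mk_surjective _ r
    rfl

/-- `T²` of `A = P/I`, for a polynomial ring `P` and an ideal `I` generated by the `g p`: the
cokernel of `Hom_P(P^ι, A) → Hom_A(R/R₀, A)`. -/
abbrev TTwo : Type _ := RelHom g ⧸ LinearMap.range (restrictHom g)

end Presentation

/-! ### The Stanley-Reisner ring and its `ℤ^V`-grading -/

/-- The square-free monomial `x^p`. -/
def sqfree (p : Finset V) : MvPolynomial V ℂ := ∏ i ∈ p, MvPolynomial.X i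

instance nonfaceFintype [Fintype V] (X : Complex V) : Fintype {p : Finset V // p ∉ X} :=
  open Classical in inferInstance

/-- The generators `x^p`, `p ∉ X`, of the Stanley-Reisner ideal. -/
def srGen (X : Complex V) (p : {p : Finset V // p ∉ X}) : MvPolynomial V ℂ := sqfree p.1

/-- The Stanley-Reisner ideal `I_X`. -/
abbrev srIdeal (X : Complex V) : Ideal (MvPolynomial V ℂ) := genIdeal (srGen X)

/-- The Stanley-Reisner ring `A_X`. -/
abbrev srRing (X : Complex V) : Type _ := MvPolynomial V ℂ ⧸ srIdeal X

/-- The characteristic vector of a subset of `V`. -/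
def charVec (p : Finset V) : V → ℤ := fun i => if i ∈ p then 1 else 0

/-- The homogeneous summand of `P` in degree `d ∈ ℤ^V`, where `deg x_i` is the `i`-th unit
vector. -/
def polyPiece (d : V → ℤ) : Submodule ℂ (MvPolynomial V ℂ) :=
  weightedHomogeneousSubmodule ℂ (fun i : V => (Pi.single i 1 : V → ℤ)) d

/-- The homogeneous summand of `A_X` in degree `d`. -/
def ringPiece (X : Complex V) (d : V → ℤ) : Submodule ℂ (srRing X) :=
  (polyPiece d).map (Ideal.Quotient.mkₐ ℂ (srIdeal X)).toLinearMap

/-- `Hom(I_X, A_X)_c`: the maps that raise degrees by `c`. -/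
def homPiece (X : Complex V) (c : V → ℤ) :
    Submodule ℂ (srIdeal X →ₗ[MvPolynomial V ℂ] srRing X) where
  carrier := {φ | ∀ (d : V → ℤ) (f : srIdeal X), (f : MvPolynomial V ℂ) ∈ polyPiece d →
    φ f ∈ ringPiece X (d + c)}
  zero_mem' := fun _ _ _ => Submodule.zero_mem _
  add_mem' := fun hφ hψ d f hf => Submodule.add_mem _ (hφ d f hf) (hψ d f hf)
  smul_mem' := fun r _ hφ d f hf => Submodule.smul_mem _ r (hφ d f hf)

/-- `r ∈ P^{Δ ∖ X}` is homogeneous of degree `d`, where `deg e_p = p`. -/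
def IsHomogeneousOfDeg (X : Complex V) (d : V → ℤ)
    (r : {p : Finset V // p ∉ X} → MvPolynomial V ℂ) : Prop :=
  ∀ p, r p ∈ polyPiece (d - charVec p.1)

/-- `Hom(R/R₀, A_X)_c`: the maps that raise degrees by `c`. -/
def relHomPiece [Fintype V] (X : Complex V) (c : V → ℤ) : Submodule ℂ (RelHom (srGen X)) where
  carrier := {ψ | ∀ (d : V → ℤ) (r : relations (srGen X)), IsHomogeneousOfDeg X d r →
    ψ (Submodule.Quotient.mk r) ∈ ringPiece X (d + c)}
  zero_mem' := fun _ _ _ => Submodule.zero_mem _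
  add_mem' := fun hφ hψ d f hf => Submodule.add_mem _ (hφ d f hf) (hψ d f hf)
  smul_mem' := fun r _ hφ d f hf => Submodule.smul_mem _ r (hφ d f hf)

/-- The homogeneous summand `T¹_c(X)` of `T¹` of `A_X`: the classes of the homomorphisms of
degree `c`. -/
def tOne (X : Complex V) (c : V → ℤ) : Submodule ℂ (TOne (srIdeal X)) :=
  (homPiece X c).map ((LinearMap.range (derToHom (srIdeal X))).mkQ.restrictScalars ℂ)

/-- The homogeneous summand `T²_c(X)` of `T²` of `A_X`: the classes of the homomorphisms of
degree `c`. -/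
def tTwo [Fintype V] (X : Complex V) (c : V → ℤ) : Submodule ℂ (TTwo (srGen X)) :=
  (relHomPiece X c).map ((LinearMap.range (restrictHom (srGen X))).mkQ.restrictScalars ℂ)

/-! ### Description of classes by functions on `N` -/

/-- The generator `x^p`, `p ∉ X`, as an element of `I_X`. -/
def idealGen (X : Complex V) (p : {p : Finset V // p ∉ X}) : srIdeal X :=
  ⟨sqfree p.1, Ideal.subset_span ⟨p, rfl⟩⟩

/-- The relation `R_{p,q} = x^{q ∖ p} e_p - x^{p ∖ q} e_q`. -/
def taylorRel [Fintype V] (X : Complex V) (p q : {p : Finset V // p ∉ X}) : relations (srGen X) :=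
  ⟨Pi.single p (sqfree (q.1 \ p.1)) - Pi.single q (sqfree (p.1 \ q.1)), by
    have h : ∀ s t : Finset V, sqfree (t \ s) * sqfree s = sqfree (s ∪ t) := by
      intro s t
      rw [sqfree, sqfree, sqfree, ← Finset.prod_union Finset.sdiff_disjoint,
        Finset.sdiff_union_self_eq_union, Finset.union_comm]
    simp only [LinearMap.mem_ker, map_sub, Fintype.linearCombination_apply_single, smul_eq_mul, srGen, h]
    rw [Finset.union_comm, sub_self]⟩

/-- The image in `A_X` of the monomial `x^d`, for `d ∈ ℤ^V`; it is `0` if `d` has a negative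
entry. -/
def ringMonomial [Fintype V] (X : Complex V) (d : V → ℤ) : srRing X :=
  open Classical in
  if 0 ≤ d then Ideal.Quotient.mk (srIdeal X) (∏ i, MvPolynomial.X i ^ (d i).toNat) else 0

/-- The degree `𝐚 - b`, for an exponent vector `𝐚` and a subset `b`. -/
def degSub (α : V →₀ ℕ) (b : Finset V) : V → ℤ := fun i => (α i : ℤ) - charVec b i

/-- The function `l : N_{a-b}(X) → ℂ` represents the class `t` in `T¹_{𝐚-b}(X)`: the class `t`
contains a homomorphism `φ` of degree `𝐚 - b` with
`φ(x^p) = l(f) x^{p+𝐚-b}` whenever `f = (p ∪ a) ∖ b` lies in `N_{a-b}(X)`. -/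
def RepresentsOne [Fintype V] (X : Complex V) (α : V →₀ ℕ) (b : Finset V)
    (l : nSet X α.support b → ℂ) (t : TOne (srIdeal X)) : Prop :=
  ∃ φ ∈ homPiece X (degSub α b), Submodule.Quotient.mk φ = t ∧
    ∀ (p : {p : Finset V // p ∉ X}) (f : nSet X α.support b),
      (f : Finset V) = (p.1 ∪ α.support) \ b →
        φ (idealGen X p) = l f • ringMonomial X (charVec p.1 + degSub α b)

/-- The function `l` on the pairs `(f, g)` in `N_{a-b}(X)` with `f ∪ g ∈ X` represents the class
`t` in `T²_{𝐚-b}(X)`: the class `t` contains a homomorphism `ψ` of degree `𝐚 - b` with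
`ψ(R_{p,q}) = l(f, g) x^{(p ∪ q)+𝐚-b}` whenever `f = (p ∪ a) ∖ b` and `g = (q ∪ a) ∖ b` lie in
`N_{a-b}(X)` and `f ∪ g ∈ X`. (Values of `l` on pairs with `f ∪ g ∉ X` are ignored.) -/
def RepresentsTwo [Fintype V] (X : Complex V) (α : V →₀ ℕ) (b : Finset V)
    (l : nSet X α.support b → nSet X α.support b → ℂ) (t : TTwo (srGen X)) : Prop :=
  ∃ ψ ∈ relHomPiece X (degSub α b), Submodule.Quotient.mk ψ = t ∧
    ∀ (p q : {p : Finset V // p ∉ X}) (f g : nSet X α.support b),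
      (f : Finset V) = (p.1 ∪ α.support) \ b → (g : Finset V) = (q.1 ∪ α.support) \ b →
      (f : Finset V) ∪ (g : Finset V) ∈ X →
        ψ (Submodule.Quotient.mk (taylorRel X p q)) =
          l f g • ringMonomial X (charVec (p.1 ∪ q.1) + degSub α b)

end StanleyReisner

end

/-! Each graded piece of `A_X` is spanned by at most one monomial, so a homomorphism of degree 𝐚 - b
is a table of scalars, one for each generator. In the degree of a square-free `x^U` the target
monomial x^{U+𝐚-b} survives exactly when b ⊆ U and (U ∪ a) \ b is a face; if U is a non-face, this
face lies in N_{a-b}(X). Linearity then makes the scalars depend, for i = 2 after subtracting a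
trivial homomorphism, only on such faces:

For i = 1, λ represents some class iff λ f = λ g whenever f ∪ g ∈ X and λ = 0 on Ñ. It represents 0
iff it is constant, with constant 0 unless |b| = 1 (`exists_representsOne_iff`,
`representsOne_zero_iff`).

For i = 2, λ represents some class iff λ(f,g) + λ(g,h) = λ(f,h) whenever f ∪ g ∪ h ∈ X and λ
vanishes on pairs from Ñ whose union is a face. It represents 0 iff λ(f,g) = ν(f) - ν(g) for such
pairs in N, with some ν that is zero on Ñ (`exists_representsTwo_iff`, `representsTwo_zero_iff`).

The set Ñ enters because its faces also arise from non-faces p not containing b, for which x^{p+𝐚-b}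
has a negative exponent; comparison with such p kills scalars.

Part (2): these conditions mention only N, Ñ and the question which unions are faces, and f ↦ f \ a
preserves all three. Representation is the graph of a linear map onto T^i in the given degree, so
matching domains and kernels give the isomorphism (`IsLinearParam.exists_linearEquiv`).

Part (1): if a ∉ X or 𝐛 is not square-free, no monomial of the relevant degrees survives. Otherwise
some v ∈ b has a ∪ {v} ∉ X. If b = {v}, the face a is the least element of N and contracts every
cocycle; if |b| ≥ 2, the subset {v} shows N = Ñ. Either way every cocycle is a coboundary. -/

namespace StanleyReisner

open MvPolynomial

set_option linter.unusedSectionVars false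

noncomputable section

/-! ### Monomials and multidegrees in the Stanley–Reisner ring -/

section

variable {V : Type*} [DecidableEq V]

/-- The exponent vector of the square-free monomial `x^p`. -/
def sqfreeExp (p : Finset V) : V →₀ ℕ := ∑ i ∈ p, Finsupp.single i 1

lemma sqfreeExp_apply (p : Finset V) (i : V) : sqfreeExp p i = if i ∈ p then 1 else 0 := by
  simp [sqfreeExp, Finsupp.finsetSum_apply, Finsupp.single_apply]

lemma sqfree_eq_monomial (p : Finset V) : sqfree p = monomial (sqfreeExp p) 1 := by
  rw [sqfreeExp, monomial_sum_one]
  rfl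

lemma sqfreeExp_le_iff (p : Finset V) (m : V →₀ ℕ) : sqfreeExp p ≤ m ↔ p ⊆ m.support := by
  constructor
  · intro h i hi
    have := h i
    rw [sqfreeExp_apply, if_pos hi] at this
    simp only [Finsupp.mem_support_iff]
    omega
  · intro h i
    rw [sqfreeExp_apply]
    split_ifs with hi
    · have := h hi
      simp only [Finsupp.mem_support_iff] at this
      omega
    · exact Nat.zero_le _

lemma support_sqfreeExp (p : Finset V) : (sqfreeExp p).support = p := by
  ext i
  simp [sqfreeExp_apply]

/-- The ideal is monomial. A non-face dividing a monomial forces its support to be a non-face by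
down-closure, and conversely the support itself is then a generator dividing it. -/
lemma mem_srIdeal (X : Complex V) (f : MvPolynomial V ℂ) :
    f ∈ srIdeal X ↔ ∀ m ∈ f.support, m.support ∉ X := by
  have h : Set.range (srGen X) =
      (fun m => monomial m (1 : ℂ)) '' {m | ∃ p : Finset V, p ∉ X ∧ m = sqfreeExp p} := by
    ext g
    constructor
    · rintro ⟨p, rfl⟩
      exact ⟨_, ⟨p.1, p.2, rfl⟩, (sqfree_eq_monomial p.1).symm⟩
    · rintro ⟨_, ⟨p, hp, rfl⟩, rfl⟩
      exact ⟨⟨p, hp⟩, sqfree_eq_monomial p⟩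
  rw [srIdeal, genIdeal, h, mem_ideal_span_monomial_image]
  refine forall₂_congr fun m _ => ⟨?_, fun hm => ?_⟩
  · rintro ⟨_, ⟨p, hp, rfl⟩, hle⟩ hX
    exact hp (X.down_closed hX ((sqfreeExp_le_iff p m).1 hle))
  · exact ⟨_, ⟨m.support, hm, rfl⟩, (sqfreeExp_le_iff _ m).2 subset_rfl⟩

lemma coeff_eq_of_mk_eq {X : Complex V} {f g : MvPolynomial V ℂ}
    (h : Ideal.Quotient.mk (srIdeal X) f = Ideal.Quotient.mk (srIdeal X) g)
    {m : V →₀ ℕ} (hm : m.support ∈ X) : coeff m f = coeff m g := by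
  rw [Ideal.Quotient.eq, mem_srIdeal] at h
  by_contra hne
  exact h m (by rwa [mem_support_iff, coeff_sub, sub_ne_zero]) hm

lemma mk_monomial_eq_zero {X : Complex V} {m : V →₀ ℕ} (hm : m.support ∉ X) (r : ℂ) :
    Ideal.Quotient.mk (srIdeal X) (monomial m r) = 0 := by
  rw [Ideal.Quotient.eq_zero_iff_mem, mem_srIdeal]
  intro k hk
  have := support_monomial_subset hk
  simp only [Finset.mem_singleton] at this
  rwa [this]

/-- An exponent vector as a degree. -/
def degOf (m : V →₀ ℕ) : V → ℤ := fun i => (m i : ℤ)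

lemma degOf_injective : Function.Injective (degOf : (V →₀ ℕ) → V → ℤ) := by
  intro m k h
  ext i
  have := congrFun h i
  simp only [degOf] at this
  omega

lemma degOf_nonneg (m : V →₀ ℕ) : 0 ≤ degOf m := fun i => by simp [degOf]

lemma degOf_add (m k : V →₀ ℕ) : degOf (m + k) = degOf m + degOf k := by
  ext i
  simp [degOf]

lemma degOf_sqfreeExp (p : Finset V) : degOf (sqfreeExp p) = charVec p := by
  ext i
  simp [degOf, sqfreeExp_apply, charVec]

lemma weight_eq_degOf (m : V →₀ ℕ) :
    Finsupp.weight (fun i : V => (Pi.single i 1 : V → ℤ)) m = degOf m := by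
  ext j
  rw [Finsupp.weight_apply, Finsupp.sum, Finset.sum_apply]
  simp only [Pi.smul_apply, Pi.single_apply, degOf, smul_ite, nsmul_eq_mul, mul_one, mul_zero,
    Finset.sum_ite_eq, Finsupp.mem_support_iff]
  split_ifs with h <;> simp_all

lemma mem_polyPiece {d : V → ℤ} {f : MvPolynomial V ℂ} :
    f ∈ polyPiece d ↔ ∀ m, coeff m f ≠ 0 → degOf m = d := by
  rw [polyPiece, mem_weightedHomogeneousSubmodule, IsWeightedHomogeneous]
  exact forall_congr' fun m => by rw [weight_eq_degOf]

lemma monomial_mem_polyPiece (m : V →₀ ℕ) (r : ℂ) : monomial m r ∈ polyPiece (degOf m) := by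
  rw [mem_polyPiece]
  intro k hk
  rw [coeff_monomial] at hk
  split_ifs at hk with h
  · rw [h]
  · exact absurd rfl hk

section Fintype

variable [Fintype V]

lemma exists_degOf_eq {d : V → ℤ} (hd : 0 ≤ d) : ∃ m : V →₀ ℕ, degOf m = d :=
  ⟨Finsupp.equivFunOnFinite.symm fun i => (d i).toNat, by
    ext i
    have := hd i
    simp only [Pi.zero_apply] at this
    simp [degOf, this]⟩

lemma ringMonomial_degOf (X : Complex V) (m : V →₀ ℕ) :
    ringMonomial X (degOf m) = Ideal.Quotient.mk (srIdeal X) (monomial m 1) := by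
  rw [ringMonomial, if_pos (degOf_nonneg m), monomial_eq]
  simp [degOf, Finsupp.prod_fintype]

lemma ringMonomial_of_not_nonneg (X : Complex V) {d : V → ℤ} (hd : ¬ 0 ≤ d) :
    ringMonomial X d = 0 := by
  rw [ringMonomial, if_neg hd]

lemma ringMonomial_degOf_eq_zero_iff (X : Complex V) (m : V →₀ ℕ) :
    ringMonomial X (degOf m) = 0 ↔ m.support ∉ X := by
  rw [ringMonomial_degOf]
  refine ⟨fun h hm => ?_, fun h => mk_monomial_eq_zero h 1⟩
  rw [← map_zero (Ideal.Quotient.mk (srIdeal X))] at h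
  simpa using coeff_eq_of_mk_eq h hm

lemma monomial_smul_ringMonomial (X : Complex V) (m : V →₀ ℕ) {d : V → ℤ} (hd : 0 ≤ d) :
    (monomial m (1 : ℂ)) • ringMonomial X d = ringMonomial X (degOf m + d) := by
  obtain ⟨k, rfl⟩ := exists_degOf_eq hd
  rw [← degOf_add, ringMonomial_degOf, ringMonomial_degOf, Algebra.smul_def,
    Ideal.Quotient.algebraMap_eq, ← map_mul, monomial_mul, one_mul]

/-- A degree in ℤ^V determines its monomial, so pieces are at most one-dimensional. This turns
homogeneous homomorphisms into tables of scalars. -/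
lemma mem_ringPiece {X : Complex V} {d : V → ℤ} {y : srRing X} :
    y ∈ ringPiece X d ↔ ∃ r : ℂ, y = r • ringMonomial X d := by
  constructor
  · rintro ⟨f, hf, rfl⟩
    have hf' := mem_polyPiece.1 hf
    by_cases hd : 0 ≤ d
    · obtain ⟨k, rfl⟩ := exists_degOf_eq hd
      refine ⟨coeff k f, ?_⟩
      have h : f = coeff k f • monomial k (1 : ℂ) := by
        ext m
        rw [coeff_smul, coeff_monomial]
        split_ifs with hmk
        · simp [hmk]
        · by_contra hne
          exact hmk (degOf_injective (hf' m (by simpa using hne))).symm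
      rw [ringMonomial_degOf]
      conv_lhs => rw [h]
      rfl
    · refine ⟨0, ?_⟩
      have h : f = 0 := by
        ext m
        by_contra hne
        exact hd (hf' m hne ▸ degOf_nonneg m)
      simp [h]
  · rintro ⟨r, rfl⟩
    refine Submodule.smul_mem _ _ ?_
    by_cases hd : 0 ≤ d
    · obtain ⟨k, rfl⟩ := exists_degOf_eq hd
      exact ⟨_, monomial_mem_polyPiece k 1, (ringMonomial_degOf X k).symm⟩
    · rw [ringMonomial_of_not_nonneg X hd]
      exact Submodule.zero_mem _

lemma eq_zero_of_mem_ringPiece {X : Complex V} {d : V → ℤ} {y : srRing X}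
    (hy : y ∈ ringPiece X d) (hd : ringMonomial X d = 0) : y = 0 := by
  obtain ⟨r, rfl⟩ := mem_ringPiece.1 hy
  rw [hd, smul_zero]

lemma charVec_add_degSub_nonneg {α : V →₀ ℕ} {b U : Finset V} (hab : Disjoint α.support b) :
    0 ≤ charVec U + degSub α b ↔ b ⊆ U := by
  constructor
  · intro h i hi
    have h1 := h i
    have h2 : α i = 0 := by
      by_contra hne
      exact Finset.disjoint_left.1 hab (Finsupp.mem_support_iff.2 hne) hi
    by_contra hU
    simp [charVec, degSub, hi, h2, hU] at h1
  · intro h i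
    simp only [charVec, degSub, Pi.zero_apply, Pi.add_apply]
    by_cases hi : i ∈ b
    · simp [hi, h hi]
    · simp only [hi, if_false]
      split_ifs <;> omega

lemma support_of_degOf_eq {α : V →₀ ℕ} {b U : Finset V} (hab : Disjoint α.support b)
    {m : V →₀ ℕ} (hm : degOf m = charVec U + degSub α b) :
    m.support = (U ∪ α.support) \ b := by
  ext i
  have h1 := congrFun hm i
  have h2 : i ∈ b → α i = 0 := fun hi => by
    by_contra hne
    exact Finset.disjoint_left.1 hab (Finsupp.mem_support_iff.2 hne) hi
  simp only [degOf, charVec, degSub, Pi.add_apply] at h1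
  simp only [Finsupp.mem_support_iff, Finset.mem_sdiff, Finset.mem_union]
  by_cases hi : i ∈ b
  · simp only [hi, h2 hi, if_true] at h1 ⊢
    split_ifs at h1 <;> simp <;> omega
  · simp only [hi, if_false] at h1 ⊢
    split_ifs at h1 with hU <;> simp [hU] <;> omega

/-- Since 𝐚 vanishes on b, the exponents stay non-negative only if b ⊆ U; since U is square-free,
subtracting b then removes all of b from the support. -/
lemma ringMonomial_ne_zero_iff {X : Complex V} {α : V →₀ ℕ} {b U : Finset V}
    (hab : Disjoint α.support b) :
    ringMonomial X (charVec U + degSub α b) ≠ 0 ↔ b ⊆ U ∧ (U ∪ α.support) \ b ∈ X := by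
  by_cases hU : b ⊆ U
  · obtain ⟨m, hm⟩ := exists_degOf_eq ((charVec_add_degSub_nonneg hab).2 hU)
    rw [← hm, Ne, ringMonomial_degOf_eq_zero_iff, not_not, support_of_degOf_eq hab hm]
    simp [hU]
  · simp [hU, ringMonomial_of_not_nonneg X (mt (charVec_add_degSub_nonneg hab).1 hU)]

lemma charVec_sdiff_add {U W : Finset V} (h : U ⊆ W) :
    charVec (W \ U) + charVec U = charVec W := by
  ext i
  by_cases hi : i ∈ U
  · simp [charVec, hi, h hi]
  · simp [charVec, hi]

lemma sqfree_smul_ringMonomial (X : Complex V) {α : V →₀ ℕ} {b U W : Finset V}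
    (hab : Disjoint α.support b) (hb : b ⊆ U) (h : U ⊆ W) :
    sqfree (W \ U) • ringMonomial X (charVec U + degSub α b) =
      ringMonomial X (charVec W + degSub α b) := by
  rw [sqfree_eq_monomial, monomial_smul_ringMonomial X _ ((charVec_add_degSub_nonneg hab).2 hb),
    degOf_sqfreeExp, ← add_assoc, charVec_sdiff_add h]

end Fintype

end

/-! ### Functions on N and homomorphisms from the Stanley–Reisner ideal -/

section

/-- A `ℂ`-linear map that commutes with the variables on a submodule `N` restricts to a
`P`-linear map on `N`. -/
def restrictOfXSMul {V F M : Type*} [AddCommGroup F] [Module (MvPolynomial V ℂ) F] [Module ℂ F]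
    [IsScalarTower ℂ (MvPolynomial V ℂ) F] [AddCommGroup M] [Module (MvPolynomial V ℂ) M]
    [Module ℂ M] [IsScalarTower ℂ (MvPolynomial V ℂ) M] (N : Submodule (MvPolynomial V ℂ) F)
    (Φ : F →ₗ[ℂ] M)
    (h : ∀ (i : V), ∀ w ∈ N, Φ ((X i : MvPolynomial V ℂ) • w) = (X i : MvPolynomial V ℂ) • Φ w) :
    N →ₗ[MvPolynomial V ℂ] M where
  toFun w := Φ w
  map_add' w w' := by simp
  map_smul' r w := by
    obtain ⟨w, hw⟩ := w
    simp only [Submodule.coe_smul, RingHom.id_apply]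
    induction r using MvPolynomial.induction_on generalizing w with
    | C r =>
      rw [← mul_one (C r), ← smul_eq_C_mul, smul_assoc, smul_assoc, one_smul, one_smul, map_smul]
    | add p q hp hq => rw [add_smul, add_smul, map_add, hp w hw, hq w hw]
    | mul_X p i hp => rw [mul_smul, mul_smul, hp _ (N.smul_mem _ hw), h i w hw]

variable {V : Type*} [DecidableEq V]

/-- The set `(p ∪ a) ∖ b`. -/
def trunc (a b p : Finset V) : Finset V := (p ∪ a) \ b

lemma trunc_mono (a b : Finset V) {p q : Finset V} (h : p ⊆ q) : trunc a b p ⊆ trunc a b q :=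
  Finset.sdiff_subset_sdiff (Finset.union_subset_union_left h) subset_rfl

lemma trunc_union (a b p q : Finset V) : trunc a b (p ∪ q) = trunc a b p ∪ trunc a b q := by
  ext i; simp only [trunc, Finset.mem_sdiff, Finset.mem_union]; tauto

lemma subset_trunc_union (a b p : Finset V) : p ⊆ trunc a b p ∪ (p ∩ b) := by
  intro i hi; simp only [trunc, Finset.mem_sdiff, Finset.mem_union, Finset.mem_inter]; tauto

section Combinatorics

variable {X : Complex V} {a b : Finset V}

/-- Together with b the truncation covers p, so this union cannot be a face. -/
lemma trunc_mem_nSet (hab : Disjoint a b) {p : Finset V} (hp : p ∉ X) (h : trunc a b p ∈ X) :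
    trunc a b p ∈ nSet X a b := by
  refine ⟨h, ?_, Finset.sdiff_inter_self _ _, fun hX => hp (X.down_closed hX ?_)⟩
  · exact fun i hi => Finset.mem_sdiff.2
      ⟨Finset.mem_union_right _ hi, Finset.disjoint_left.1 hab hi⟩
  · exact (subset_trunc_union a b p).trans
      (Finset.union_subset_union_right Finset.inter_subset_right)

lemma trunc_union_subset {f b' : Finset V} (hf : f ∈ nSet X a b) (hb : b' ⊆ b) :
    trunc a b (f ∪ b') = f := by
  have h1 := hf.2.1
  have h2 : ∀ i ∈ f, i ∉ b := Finset.disjoint_left.1 (Finset.disjoint_iff_inter_eq_empty.2 hf.2.2.1)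
  ext i
  have h3 := @h1 i
  have h4 := @hb i
  have h5 := h2 i
  simp only [trunc, Finset.mem_sdiff, Finset.mem_union]
  tauto

lemma trunc_union_self {f : Finset V} (hf : f ∈ nSet X a b) : trunc a b (f ∪ b) = f :=
  trunc_union_subset hf subset_rfl

lemma union_mem_nSet {f g : Finset V} (hf : f ∈ nSet X a b) (hg : g ∈ nSet X a b)
    (h : f ∪ g ∈ X) : f ∪ g ∈ nSet X a b := by
  refine ⟨h, hf.2.1.trans Finset.subset_union_left, ?_, fun hX => hf.2.2.2 (X.down_closed hX ?_)⟩
  · rw [Finset.union_inter_distrib_right, hf.2.2.1, hg.2.2.1, Finset.union_empty]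
  · exact Finset.union_subset_union_left Finset.subset_union_left

lemma nTilde_of_subset {f g : Finset V} (hf : f ∈ nTilde X a b) (hg : g ∈ nSet X a b)
    (h : f ⊆ g) : g ∈ nTilde X a b := by
  obtain ⟨-, b', hb', hX⟩ := hf
  exact ⟨hg, b', hb', fun hX' => hX (X.down_closed hX' (Finset.union_subset_union_left h))⟩

/-- The proper subset of b is p ∩ b. This is how Ñ arises: from non-faces p that miss part of b,
where x^{p+𝐚-b} has a negative exponent. -/
lemma trunc_mem_nTilde (hab : Disjoint a b) {p : Finset V} (hp : p ∉ X) (h : trunc a b p ∈ X)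
    (hb : ¬ b ⊆ p) : trunc a b p ∈ nTilde X a b :=
  ⟨trunc_mem_nSet hab hp h, p ∩ b,
    ⟨Finset.inter_subset_right, fun h' => hb (h'.trans Finset.inter_subset_left)⟩,
    fun hX => hp (X.down_closed hX (subset_trunc_union a b p))⟩

/-- The functions on `N_{a-b}(X)` that come from homomorphisms `I_X → A_X`. -/
def IsCocycleOne (X : Complex V) (a b : Finset V) (l : nSet X a b → ℂ) : Prop :=
  (∀ f g : nSet X a b, (f : Finset V) ∪ (g : Finset V) ∈ X → l f = l g) ∧
    ∀ f : nSet X a b, (f : Finset V) ∈ nTilde X a b → l f = 0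

/-- The functions on `N_{a-b}(X)` that come from derivations. -/
def IsCoboundaryOne (X : Complex V) (a b : Finset V) (l : nSet X a b → ℂ) : Prop :=
  ∃ r : ℂ, (b.card ≠ 1 → r = 0) ∧ ∀ f, l f = r

lemma nTilde_eq_empty_of_card_eq_one (hb : b.card = 1) (f : Finset V) : f ∉ nTilde X a b := by
  rintro ⟨hf, b', hb', hX⟩
  have h0 : b' = ∅ := by
    rw [← Finset.card_eq_zero]
    have := Finset.card_lt_card hb'
    omega
  exact hX (by rw [h0, Finset.union_empty]; exact hf.1)

lemma IsCoboundaryOne.isCocycleOne {l : nSet X a b → ℂ} (h : IsCoboundaryOne X a b l) :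
    IsCocycleOne X a b l := by
  obtain ⟨r, hr, hl⟩ := h
  refine ⟨fun f g _ => by rw [hl, hl], fun f hf => ?_⟩
  by_cases hb : b.card = 1
  · exact absurd hf (nTilde_eq_empty_of_card_eq_one hb _)
  · rw [hl, hr hb]

/-- The coefficient at `x^U` of the homomorphism defined by a function `l` on `N_{a-b}(X)`. -/
def coeffOne (l : nSet X a b → ℂ) (U : Finset V) : ℂ :=
  open Classical in
  if h : b ⊆ U ∧ trunc a b U ∈ nSet X a b then l ⟨trunc a b U, h.2⟩ else 0

lemma coeffOne_of_not_subset (l : nSet X a b → ℂ) {U : Finset V} (h : ¬ b ⊆ U) :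
    coeffOne l U = 0 := by
  rw [coeffOne, dif_neg fun h' => h h'.1]

lemma coeffOne_of_subset (l : nSet X a b → ℂ) {U : Finset V} (h : b ⊆ U)
    (hU : trunc a b U ∈ nSet X a b) : coeffOne l U = l ⟨trunc a b U, hU⟩ := by
  rw [coeffOne, dif_pos ⟨h, hU⟩]

/-- The combinatorial form of P-linearity. If U misses part of b, its scalar is 0 by convention, and
the scalar of W is 0 because the truncation of W contains a member of Ñ. -/
lemma IsCocycleOne.coeffOne_eq (hab : Disjoint a b) {l : nSet X a b → ℂ}
    (hl : IsCocycleOne X a b l) {U W : Finset V} (hU : U ∉ X) (hUW : U ⊆ W) (hb : b ⊆ W)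
    (hW : trunc a b W ∈ X) : coeffOne l W = coeffOne l U := by
  have hWX : W ∉ X := fun h => hU (X.down_closed h hUW)
  have hUt : trunc a b U ∈ X := X.down_closed hW (trunc_mono a b hUW)
  rw [coeffOne_of_subset l hb (trunc_mem_nSet hab hWX hW)]
  by_cases hbU : b ⊆ U
  · rw [coeffOne_of_subset l hbU (trunc_mem_nSet hab hU hUt)]
    exact hl.1 _ _ (by rwa [Finset.union_eq_left.2 (trunc_mono a b hUW)])
  · rw [coeffOne_of_not_subset l hbU]
    exact hl.2 _ (nTilde_of_subset (trunc_mem_nTilde hab hU hUt hbU)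
      (trunc_mem_nSet hab hWX hW) (trunc_mono a b hUW))

end Combinatorics

section Degrees

variable {α : V →₀ ℕ} {b : Finset V}

lemma degOf_add_degSub_nonneg (hab : Disjoint α.support b) (d : V →₀ ℕ) :
    0 ≤ degOf d + degSub α b ↔ b ⊆ d.support := by
  constructor
  · intro h i hi
    have h1 := h i
    have h2 : α i = 0 := by
      by_contra hne
      exact Finset.disjoint_left.1 hab (Finsupp.mem_support_iff.2 hne) hi
    simp only [degOf, charVec, degSub, hi, h2, Pi.zero_apply, Pi.add_apply, if_true] at h1
    rw [Finsupp.mem_support_iff]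
    omega
  · intro h i
    simp only [degOf, charVec, degSub, Pi.zero_apply, Pi.add_apply]
    by_cases hi : i ∈ b
    · have := Finsupp.mem_support_iff.1 (h hi)
      simp only [hi, if_true]
      omega
    · simp only [hi, if_false]
      omega

variable [Fintype V]

/-- Only one implication is available for general d: a point of b at which d is at least 2 stays in
the support, so the converse can fail. -/
lemma of_ringMonomial_ne_zero (hab : Disjoint α.support b) {X : Complex V} {d : V →₀ ℕ}
    (h : ringMonomial X (degOf d + degSub α b) ≠ 0) :
    b ⊆ d.support ∧ trunc α.support b d.support ∈ X := by
  by_cases hd : 0 ≤ degOf d + degSub α b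
  · refine ⟨(degOf_add_degSub_nonneg hab d).1 hd, ?_⟩
    obtain ⟨m, hm⟩ := exists_degOf_eq hd
    rw [← hm, Ne, ringMonomial_degOf_eq_zero_iff, not_not] at h
    refine X.down_closed h fun i hi => ?_
    have h1 := congrFun hm i
    simp only [trunc, Finset.mem_sdiff, Finset.mem_union, Finsupp.mem_support_iff] at hi ⊢
    simp only [degOf, charVec, degSub, Pi.add_apply, hi.2, if_false] at h1
    omega
  · exact absurd (ringMonomial_of_not_nonneg X hd) h

lemma X_smul_ringMonomial (hab : Disjoint α.support b) (Y : Complex V) {d : V →₀ ℕ}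
    (h : b ⊆ d.support) (i : V) :
    (X i : MvPolynomial V ℂ) • ringMonomial Y (degOf d + degSub α b) =
      ringMonomial Y (degOf (Finsupp.single i 1 + d) + degSub α b) := by
  rw [X, monomial_smul_ringMonomial Y _ ((degOf_add_degSub_nonneg hab d).2 h), degOf_add, add_assoc]

end Degrees

section HomOne

lemma monomial_eq_smul_one (d : V →₀ ℕ) (r : ℂ) : monomial d r = r • monomial d (1 : ℂ) := by
  rw [smul_monomial, smul_eq_mul, mul_one]

lemma sqfree_mem_polyPiece (p : Finset V) : sqfree p ∈ polyPiece (charVec p) := by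
  rw [sqfree_eq_monomial, ← degOf_sqfreeExp]
  exact monomial_mem_polyPiece _ _

lemma sqfree_sdiff_mul {U W : Finset V} (h : U ⊆ W) : sqfree (W \ U) * sqfree U = sqfree W :=
  Finset.prod_sdiff h

lemma sqfree_smul_idealGen {X : Complex V} (p q : {p : Finset V // p ∉ X}) (h : p.1 ⊆ q.1) :
    sqfree (q.1 \ p.1) • idealGen X p = idealGen X q :=
  Subtype.ext (sqfree_sdiff_mul h)

lemma ideal_hom_ext {X : Complex V} {φ φ' : srIdeal X →ₗ[MvPolynomial V ℂ] srRing X}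
    (h : ∀ p, φ (idealGen X p) = φ' (idealGen X p)) : φ = φ' := by
  refine LinearMap.ext fun ⟨f, hf⟩ => ?_
  induction hf using Submodule.span_induction with
  | mem g hg =>
    obtain ⟨p, rfl⟩ := hg
    exact h p
  | zero => exact (map_zero φ).trans (map_zero φ').symm
  | add f g hf hg h1 h2 =>
    have := congrArg₂ (· + ·) h1 h2
    simp only [← map_add] at this
    exact this
  | smul r f hf h1 =>
    have := congrArg (r • ·) h1
    simp only [← map_smul] at this
    exact this

lemma apply_idealGen_mem {X : Complex V} {c : V → ℤ}
    {φ : srIdeal X →ₗ[MvPolynomial V ℂ] srRing X} (hφ : φ ∈ homPiece X c)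
    (p : {p : Finset V // p ∉ X}) : φ (idealGen X p) ∈ ringPiece X (charVec p.1 + c) :=
  hφ _ _ (sqfree_mem_polyPiece p.1)

variable [Fintype V] {Y : Complex V} {α : V →₀ ℕ} {b : Finset V}

/-- Auxiliary `ℂ`-linear map `P → A_X`, `x^d ↦ l((supp d ∪ a) ∖ b) x^{d+𝐚-b}`. -/
def preHomOne (l : nSet Y α.support b → ℂ) : MvPolynomial V ℂ →ₗ[ℂ] srRing Y :=
  (basisMonomials V ℂ).constr ℂ fun d =>
    coeffOne l d.support • ringMonomial Y (degOf d + degSub α b)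

lemma preHomOne_monomial (l : nSet Y α.support b → ℂ) (d : V →₀ ℕ) :
    preHomOne l (monomial d 1) = coeffOne l d.support • ringMonomial Y (degOf d + degSub α b) := by
  have := (basisMonomials V ℂ).constr_basis ℂ (fun d =>
    coeffOne l d.support • ringMonomial Y (degOf d + degSub α b)) d
  rwa [coe_basisMonomials] at this

lemma preHomOne_X_smul_monomial (hab : Disjoint α.support b) {l : nSet Y α.support b → ℂ}
    (hl : IsCocycleOne Y α.support b l) (i : V) {d : V →₀ ℕ} (hd : d.support ∉ Y) :
    preHomOne l ((X i : MvPolynomial V ℂ) • monomial d 1) =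
      (X i : MvPolynomial V ℂ) • preHomOne l (monomial d 1) := by
  have h1 : (X i : MvPolynomial V ℂ) • monomial d (1 : ℂ) = monomial (Finsupp.single i 1 + d) 1 := by
    rw [X, smul_eq_mul, monomial_mul, one_mul]
  have h2 : d.support ⊆ (Finsupp.single i 1 + d).support := by
    intro j hj
    simp only [Finsupp.mem_support_iff, Finsupp.add_apply] at hj ⊢
    omega
  rw [h1, preHomOne_monomial, preHomOne_monomial, smul_comm]
  have h3 : coeffOne l d.support • (X i : MvPolynomial V ℂ) •
      ringMonomial Y (degOf d + degSub α b) = coeffOne l d.support •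
        ringMonomial Y (degOf (Finsupp.single i 1 + d) + degSub α b) := by
    by_cases hb : b ⊆ d.support
    · rw [X_smul_ringMonomial hab Y hb]
    · rw [coeffOne_of_not_subset l hb, zero_smul, zero_smul]
  rw [h3]
  by_cases h0 : ringMonomial Y (degOf (Finsupp.single i 1 + d) + degSub α b) = 0
  · rw [h0, smul_zero, smul_zero]
  · obtain ⟨h4, h5⟩ := of_ringMonomial_ne_zero hab h0
    rw [hl.coeffOne_eq hab hd h2 h4 h5]

lemma preHomOne_X_smul (hab : Disjoint α.support b) {l : nSet Y α.support b → ℂ}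
    (hl : IsCocycleOne Y α.support b l) (i : V) (f : MvPolynomial V ℂ) (hf : f ∈ srIdeal Y) :
    preHomOne l ((X i : MvPolynomial V ℂ) • f) = (X i : MvPolynomial V ℂ) • preHomOne l f := by
  rw [f.as_sum, Finset.smul_sum, map_sum, map_sum, Finset.smul_sum]
  refine Finset.sum_congr rfl fun d hd => ?_
  rw [monomial_eq_smul_one, smul_comm, map_smul,
    preHomOne_X_smul_monomial hab hl i ((mem_srIdeal Y f).1 hf d hd),
    LinearMap.map_smul (preHomOne l), smul_comm]

/-- The homomorphism `I_X → A_X` of degree `𝐚 - b` defined by a function on `N_{a-b}(X)`. -/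
def homOne (hab : Disjoint α.support b) {l : nSet Y α.support b → ℂ}
    (hl : IsCocycleOne Y α.support b l) : srIdeal Y →ₗ[MvPolynomial V ℂ] srRing Y :=
  restrictOfXSMul (srIdeal Y) (preHomOne l) (preHomOne_X_smul hab hl)

lemma homOne_mem (hab : Disjoint α.support b) {l : nSet Y α.support b → ℂ}
    (hl : IsCocycleOne Y α.support b l) : homOne hab hl ∈ homPiece Y (degSub α b) := by
  rintro D ⟨f, hf'⟩ hf
  rw [mem_polyPiece] at hf
  change preHomOne l f ∈ _
  rw [f.as_sum, map_sum]
  refine Submodule.sum_mem _ fun d hd => ?_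
  rw [monomial_eq_smul_one, map_smul, preHomOne_monomial, hf d (mem_support_iff.1 hd)]
  exact Submodule.smul_mem _ _ (mem_ringPiece.2 ⟨_, rfl⟩)

lemma homOne_idealGen (hab : Disjoint α.support b) {l : nSet Y α.support b → ℂ}
    (hl : IsCocycleOne Y α.support b l) (p : {p : Finset V // p ∉ Y}) :
    homOne hab hl (idealGen Y p) = coeffOne l p.1 • ringMonomial Y (charVec p.1 + degSub α b) := by
  change preHomOne l (sqfree p.1) = _
  rw [sqfree_eq_monomial, preHomOne_monomial, support_sqfreeExp, degOf_sqfreeExp]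

lemma homOne_represents (hab : Disjoint α.support b) {l : nSet Y α.support b → ℂ}
    (hl : IsCocycleOne Y α.support b l) :
    RepresentsOne Y α b l (Submodule.Quotient.mk (homOne hab hl)) := by
  refine ⟨_, homOne_mem hab hl, rfl, fun p f hf => ?_⟩
  rw [homOne_idealGen]
  by_cases h0 : ringMonomial Y (charVec p.1 + degSub α b) = 0
  · rw [h0, smul_zero, smul_zero]
  · have hft : trunc α.support b p.1 = f := hf.symm
    have hfN : trunc α.support b p.1 ∈ nSet Y α.support b := hft ▸ f.2
    rw [coeffOne_of_subset l ((ringMonomial_ne_zero_iff hab).1 h0).1 hfN]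
    congr 2
    exact Subtype.ext hft

/-- Apply φ to x^q = x^{q \ p} x^p. If b ⊆ p, the monomial at p is carried to the non-zero monomial
at q; otherwise the monomial at p is already 0, which forces the scalar at q to vanish. -/
lemma coeff_eq_of_subset (hab : Disjoint α.support b)
    (φ : srIdeal Y →ₗ[MvPolynomial V ℂ] srRing Y) {p q : {p : Finset V // p ∉ Y}} {r s : ℂ}
    (hp : φ (idealGen Y p) = r • ringMonomial Y (charVec p.1 + degSub α b))
    (hq : φ (idealGen Y q) = s • ringMonomial Y (charVec q.1 + degSub α b))
    (hpq : p.1 ⊆ q.1) (h0 : ringMonomial Y (charVec q.1 + degSub α b) ≠ 0) :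
    (b ⊆ p.1 → s = r) ∧ (¬ b ⊆ p.1 → s = 0) := by
  rw [← sqfree_smul_idealGen p q hpq, map_smul, hp, smul_comm] at hq
  refine ⟨fun hb => ?_, fun hb => ?_⟩
  · rw [sqfree_smul_ringMonomial Y hab hb hpq] at hq
    exact (smul_left_injective ℂ h0 hq).symm
  · rw [ringMonomial_of_not_nonneg Y (mt (charVec_add_degSub_nonneg hab).1 hb), smul_zero,
      smul_zero] at hq
    exact (smul_eq_zero.1 hq.symm).resolve_right h0

/-- The non-face `f ∪ b` for `f ∈ N_{a-b}(X)`. -/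
def nonface {X : Complex V} {a b : Finset V} (f : nSet X a b) : {p : Finset V // p ∉ X} :=
  ⟨f.1 ∪ b, f.2.2.2.2⟩

lemma ringMonomial_nonface_ne_zero (hab : Disjoint α.support b) (f : nSet Y α.support b) :
    ringMonomial Y (charVec (nonface f).1 + degSub α b) ≠ 0 := by
  refine (ringMonomial_ne_zero_iff hab).2 ⟨Finset.subset_union_right, ?_⟩
  have := trunc_union_self f.2
  rw [trunc] at this
  rw [nonface, this]
  exact f.2.1

lemma apply_idealGen_nonface {l : nSet Y α.support b → ℂ}
    {φ : srIdeal Y →ₗ[MvPolynomial V ℂ] srRing Y}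
    (h : ∀ (p : {p : Finset V // p ∉ Y}) (f : nSet Y α.support b),
      (f : Finset V) = (p.1 ∪ α.support) \ b →
        φ (idealGen Y p) = l f • ringMonomial Y (charVec p.1 + degSub α b))
    (f : nSet Y α.support b) :
    φ (idealGen Y (nonface f)) = l f • ringMonomial Y (charVec (nonface f).1 + degSub α b) :=
  h _ f (trunc_union_self f.2).symm

/-- Faces f and g are compared through f ∪ g, again in N. A face of Ñ is compared with the non-face
f ∪ b', which does not contain b. -/
lemma RepresentsOne.isCocycleOne (hab : Disjoint α.support b) {l : nSet Y α.support b → ℂ}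
    {t : TOne (srIdeal Y)} (h : RepresentsOne Y α b l t) : IsCocycleOne Y α.support b l := by
  obtain ⟨φ, hφ, -, h⟩ := h
  have hle : ∀ f g : nSet Y α.support b, (f : Finset V) ⊆ g → l g = l f := fun f g hfg =>
    (coeff_eq_of_subset hab φ (apply_idealGen_nonface h f) (apply_idealGen_nonface h g)
      (Finset.union_subset_union_left hfg) (ringMonomial_nonface_ne_zero hab g)).1
        Finset.subset_union_right
  refine ⟨fun f g hfg => ?_, ?_⟩
  · rw [← hle f ⟨_, union_mem_nSet f.2 g.2 hfg⟩ Finset.subset_union_left,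
      ← hle g ⟨_, union_mem_nSet f.2 g.2 hfg⟩ Finset.subset_union_right]
  · rintro f ⟨-, b', hb', hX⟩
    have hnot : ¬ b ⊆ f.1 ∪ b' := by
      intro hb
      refine hb'.2 fun i hi => (Finset.mem_union.1 (hb hi)).resolve_left fun hif => ?_
      exact Finset.disjoint_left.1 (Finset.disjoint_iff_inter_eq_empty.2 f.2.2.2.1) hif hi
    refine (coeff_eq_of_subset hab φ (p := ⟨f.1 ∪ b', hX⟩)
      (h _ f (trunc_union_subset f.2 hb'.1).symm) (apply_idealGen_nonface h f)
      (Finset.union_subset_union_right hb'.1) (ringMonomial_nonface_ne_zero hab f)).2 hnot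

/-- Every non-face truncating to f lies in f ∪ b, so the scalar at f ∪ b governs all of those whose
monomial survives. No change of φ is needed. -/
lemma exists_representsOne (hab : Disjoint α.support b) {t : TOne (srIdeal Y)}
    (ht : t ∈ tOne Y (degSub α b)) : ∃ l, RepresentsOne Y α b l t := by
  obtain ⟨φ, hφ, rfl⟩ := ht
  choose r hr using fun p => mem_ringPiece.1 (apply_idealGen_mem hφ p)
  refine ⟨fun f => r (nonface f), φ, hφ, rfl, fun p f hf => ?_⟩
  rw [hr p]
  by_cases h0 : ringMonomial Y (charVec p.1 + degSub α b) = 0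
  · rw [h0, smul_zero, smul_zero]
  have hb := ((ringMonomial_ne_zero_iff hab).1 h0).1
  have hsub : p.1 ⊆ (nonface f).1 := by
    change p.1 ⊆ f.1 ∪ b
    rw [hf]
    exact (subset_trunc_union α.support b p.1).trans
      (Finset.union_subset_union_right Finset.inter_subset_right)
  change _ = r (nonface f) • _
  rw [(coeff_eq_of_subset hab φ (hr p) (hr (nonface f)) hsub
    (ringMonomial_nonface_ne_zero hab f)).1 hb]

lemma apply_idealGen_eq_zero_of_notMem (hab : Disjoint α.support b)
    {φ : srIdeal Y →ₗ[MvPolynomial V ℂ] srRing Y} (hφ : φ ∈ homPiece Y (degSub α b))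
    {p : {p : Finset V // p ∉ Y}} (h : ¬ (b ⊆ p.1 ∧ trunc α.support b p.1 ∈ Y)) :
    φ (idealGen Y p) = 0 :=
  eq_zero_of_mem_ringPiece (apply_idealGen_mem hφ p)
    (by_contra fun h0 => h ((ringMonomial_ne_zero_iff hab).1 h0))

lemma RepresentsOne.eq_zero (hab : Disjoint α.support b) {t : TOne (srIdeal Y)}
    (h : RepresentsOne Y α b 0 t) : t = 0 := by
  obtain ⟨φ, hφ, rfl, h⟩ := h
  suffices φ = 0 by rw [this]; rfl
  refine ideal_hom_ext fun p => ?_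
  rw [LinearMap.zero_apply]
  by_cases hp : b ⊆ p.1 ∧ trunc α.support b p.1 ∈ Y
  · rw [h p ⟨_, trunc_mem_nSet hab p.2 hp.2⟩ rfl, Pi.zero_apply, zero_smul]
  · exact apply_idealGen_eq_zero_of_notMem hab hφ hp

lemma RepresentsOne.add {l l' : nSet Y α.support b → ℂ} {t t' : TOne (srIdeal Y)}
    (h : RepresentsOne Y α b l t) (h' : RepresentsOne Y α b l' t') :
    RepresentsOne Y α b (l + l') (t + t') := by
  obtain ⟨φ, hφ, rfl, h⟩ := h
  obtain ⟨φ', hφ', rfl, h'⟩ := h'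
  refine ⟨φ + φ', Submodule.add_mem _ hφ hφ', rfl, fun p f hf => ?_⟩
  rw [LinearMap.add_apply, h p f hf, h' p f hf, Pi.add_apply, add_smul]

lemma RepresentsOne.smul {l : nSet Y α.support b → ℂ} {t : TOne (srIdeal Y)}
    (h : RepresentsOne Y α b l t) (r : ℂ) : RepresentsOne Y α b (r • l) (r • t) := by
  obtain ⟨φ, hφ, rfl, h⟩ := h
  refine ⟨r • φ, Submodule.smul_mem _ r hφ, rfl, fun p f hf => ?_⟩
  rw [LinearMap.smul_apply, h p f hf, Pi.smul_apply, smul_assoc]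

lemma RepresentsOne.mem {l : nSet Y α.support b → ℂ} {t : TOne (srIdeal Y)}
    (h : RepresentsOne Y α b l t) : t ∈ tOne Y (degSub α b) := by
  obtain ⟨φ, hφ, rfl, -⟩ := h
  exact ⟨φ, hφ, rfl⟩

end HomOne

end

/-! ### Derivations and the trivial classes in T¹ -/

section

variable {V : Type*} [DecidableEq V]

lemma derivation_sqfree (D : Derivation ℂ (MvPolynomial V ℂ) (MvPolynomial V ℂ)) (p : Finset V) :
    D (sqfree p) = ∑ i ∈ p, sqfree (p.erase i) * D (X i) := by
  induction p using Finset.induction_on with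
  | empty => simp [sqfree]
  | insert a s ha ih =>
    have h1 : sqfree (insert a s) = X a * sqfree s := Finset.prod_insert ha
    rw [h1, Derivation.leibniz, ih, Finset.sum_insert ha, Finset.erase_insert ha, smul_eq_mul,
      smul_eq_mul, add_comm, Finset.mul_sum]
    congr 1
    refine Finset.sum_congr rfl fun i hi => ?_
    have hne : a ≠ i := fun h => ha (h ▸ hi)
    have h2 : sqfree ((insert a s).erase i) = X a * sqfree (s.erase i) := by
      rw [Finset.erase_insert_of_ne hne]
      exact Finset.prod_insert fun h => ha (Finset.mem_of_mem_erase h)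
    rw [h2, mul_assoc]

lemma subset_support_sqfreeExp_add {α : V →₀ ℕ} {b f s : Finset V} (hab : Disjoint α.support b)
    (hfb : f ∩ b = ∅) (h : s ⊆ (sqfreeExp f + α).support) : Disjoint s b := by
  rw [Finset.disjoint_left]
  intro i hi hib
  have h1 := h hi
  have h2 : i ∉ f := fun hif =>
    Finset.disjoint_left.1 (Finset.disjoint_iff_inter_eq_empty.2 hfb) hif hib
  have h3 : α i = 0 := Finsupp.notMem_support_iff.1 fun hiα =>
    Finset.disjoint_left.1 hab hiα hib
  simp [sqfreeExp_apply, h2, h3] at h1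

variable [Fintype V] {Y : Complex V} {α : V →₀ ℕ} {b : Finset V}

lemma degOf_sqfreeExp_add {f : Finset V} (hfb : f ∩ b = ∅) :
    degOf (sqfreeExp f + α) = charVec (f ∪ b) + degSub α b := by
  rw [degOf_add, degOf_sqfreeExp]
  ext i
  simp only [charVec, degSub, degOf, Pi.add_apply, Finset.mem_union]
  by_cases hib : i ∈ b
  · have : i ∉ f := fun hif =>
      Finset.disjoint_left.1 (Finset.disjoint_iff_inter_eq_empty.2 hfb) hif hib
    simp [hib, this]
  · simp [hib]

lemma ringMonomial_nonface (f : nSet Y α.support b) :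
    ringMonomial Y (charVec (nonface f).1 + degSub α b) =
      Ideal.Quotient.mk (srIdeal Y) (monomial (sqfreeExp f.1 + α) 1) := by
  rw [nonface, ← degOf_sqfreeExp_add f.2.2.2.1, ringMonomial_degOf]

lemma support_mem_of_mem_nSet (f : nSet Y α.support b) : (sqfreeExp f.1 + α).support ∈ Y := by
  refine Y.down_closed f.2.1 fun i hi => ?_
  by_contra hif
  have h1 : α i = 0 := Finsupp.notMem_support_iff.1 fun h => hif (f.2.2.1 h)
  simp [sqfreeExp_apply, hif, h1] at hi

/-- Read off the coefficient of x^{f+𝐚} in D(x^{f ∪ b}), expanded by the Leibniz rule. The term at i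
contains the variables of b \ {i}, none of which occurs in x^{f+𝐚}. So only b = {i} contributes,
with the coefficient of x^𝐚 in D(x_i), which is independent of f. -/
lemma RepresentsOne.isCoboundaryOne (hab : Disjoint α.support b) {l : nSet Y α.support b → ℂ}
    (h : RepresentsOne Y α b l 0) : IsCoboundaryOne Y α.support b l := by
  obtain ⟨φ, -, h0, h⟩ := h
  obtain ⟨D, rfl⟩ := (Submodule.Quotient.mk_eq_zero _).1 h0
  have key : ∀ f : nSet Y α.support b, l f = ∑ i ∈ f.1 ∪ b,
      coeff (sqfreeExp f.1 + α) (sqfree ((f.1 ∪ b).erase i) * D (X i)) := by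
    intro f
    have h1 := apply_idealGen_nonface h f
    rw [ringMonomial_nonface] at h1
    have h2 : Ideal.Quotient.mk (srIdeal Y) (D (sqfree (f.1 ∪ b))) =
        Ideal.Quotient.mk (srIdeal Y) (l f • monomial (sqfreeExp f.1 + α) 1) := h1
    have h3 := coeff_eq_of_mk_eq h2 (support_mem_of_mem_nSet f)
    rw [derivation_sqfree, coeff_sum, coeff_smul, coeff_monomial, if_pos rfl, smul_eq_mul,
      mul_one] at h3
    exact h3.symm
  have hterm : ∀ (f : nSet Y α.support b) (i : V), ¬ b ⊆ {i} →
      coeff (sqfreeExp f.1 + α) (sqfree ((f.1 ∪ b).erase i) * D (X i)) = 0 := by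
    intro f i hi
    rw [sqfree_eq_monomial, coeff_monomial_mul', if_neg]
    rw [sqfreeExp_le_iff]
    intro hle
    refine hi fun j hj => ?_
    by_contra hji
    exact Finset.disjoint_left.1 (subset_support_sqfreeExp_add hab f.2.2.2.1 hle)
      (Finset.mem_erase.2 ⟨fun h => hji (Finset.mem_singleton.2 h), Finset.mem_union_right _ hj⟩) hj
  by_cases hb : b.card = 1
  · obtain ⟨v, rfl⟩ := Finset.card_eq_one.1 hb
    refine ⟨coeff α (D (X v)), fun h => absurd hb h, fun f => ?_⟩
    have hv : v ∉ f.1 := Finset.disjoint_singleton_right.1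
      (Finset.disjoint_iff_inter_eq_empty.2 f.2.2.2.1)
    rw [key f, Finset.sum_eq_single v]
    · rw [Finset.union_comm, ← Finset.insert_eq, Finset.erase_insert hv, sqfree_eq_monomial,
        coeff_monomial_mul, one_mul]
    · exact fun i _ hi => hterm f i fun h => hi (Finset.singleton_subset_singleton.1 h).symm
    · exact fun h => absurd (Finset.mem_union_right _ (Finset.mem_singleton_self v)) h
  · refine ⟨0, fun _ => rfl, fun f => ?_⟩
    rw [key f]
    refine Finset.sum_eq_zero fun i _ => hterm f i fun hi => ?_
    rcases Finset.subset_singleton_iff.1 hi with rfl | rfl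
    -- For empty b the set N is empty, so there is nothing to show.
    · exact f.2.2.2.2 (by rw [Finset.union_empty]; exact f.2.1)
    · exact hb (Finset.card_singleton i)

/-- For b = {v} the derivation r x^𝐚 ∂/∂x_v induces the homomorphism of the constant r. In all other
cases the function is 0. -/
lemma IsCoboundaryOne.represents (hab : Disjoint α.support b) {l : nSet Y α.support b → ℂ}
    (h : IsCoboundaryOne Y α.support b l) : RepresentsOne Y α b l 0 := by
  have hrep := homOne_represents hab h.isCocycleOne
  suffices Submodule.Quotient.mk (homOne hab h.isCocycleOne) = (0 : TOne (srIdeal Y)) by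
    rwa [this] at hrep
  rw [Submodule.Quotient.mk_eq_zero]
  obtain ⟨r, hr, hl⟩ := h
  by_cases hb : b.card = 1
  · obtain ⟨v, rfl⟩ := Finset.card_eq_one.1 hb
    refine ⟨mkDerivation ℂ fun i => if i = v then monomial α r else 0, ideal_hom_ext fun p => ?_⟩
    rw [homOne_idealGen]
    change Ideal.Quotient.mk (srIdeal Y) (mkDerivation ℂ
      (fun i => if i = v then monomial α r else 0) (sqfree p.1)) = _
    rw [derivation_sqfree]
    simp only [mkDerivation_X, mul_ite, mul_zero, Finset.sum_ite_eq']
    by_cases hv : v ∈ p.1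
    · have h1 : sqfree (p.1.erase v) * monomial α r =
          r • monomial (sqfreeExp (p.1.erase v) + α) 1 := by
        rw [sqfree_eq_monomial, monomial_mul, one_mul, monomial_eq_smul_one]
      have h2 : p.1.erase v ∩ {v} = ∅ := by simp
      have h3 : p.1.erase v ∪ {v} = p.1 := by
        rw [Finset.union_comm, ← Finset.insert_eq, Finset.insert_erase hv]
      have h4 : Ideal.Quotient.mk (srIdeal Y) (r • monomial (sqfreeExp (p.1.erase v) + α) 1) =
          r • ringMonomial Y (charVec p.1 + degSub α {v}) := by
        rw [← h3, ← degOf_sqfreeExp_add h2, ringMonomial_degOf, h3]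
        rfl
      rw [if_pos hv, h1, h4]
      by_cases hp : trunc α.support {v} p.1 ∈ Y
      · rw [coeffOne_of_subset l (Finset.singleton_subset_iff.2 hv)
          (trunc_mem_nSet hab p.2 hp), hl]
      · have h5 : ringMonomial Y (charVec p.1 + degSub α {v}) = 0 :=
          by_contra fun h0 => hp ((ringMonomial_ne_zero_iff hab).1 h0).2
        rw [h5, smul_zero, smul_zero]
    · rw [if_neg hv, coeffOne_of_not_subset l (by simpa using hv), zero_smul, map_zero]
  · have h0 : l = 0 := funext fun f => by rw [hl, hr hb]; rfl
    subst h0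
    have : (Submodule.Quotient.mk (homOne hab (IsCoboundaryOne.isCocycleOne ⟨r, hr, hl⟩)) :
      TOne (srIdeal Y)) = 0 := RepresentsOne.eq_zero hab hrep
    exact (Submodule.Quotient.mk_eq_zero _).1 this

end

/-! ### From cocycles to homomorphisms on the module of relations -/

section

variable {V : Type*} [DecidableEq V]

lemma free_induction {ι : Type*} [Fintype ι] [DecidableEq ι] {C : (ι → MvPolynomial V ℂ) → Prop}
    (zero : C 0) (add : ∀ w w', C w → C w' → C (w + w')) (smul : ∀ (r : ℂ) w, C w → C (r • w))
    (single : ∀ p m, C (Pi.single p (monomial m 1))) (w : ι → MvPolynomial V ℂ) : C w := by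
  rw [← Finset.univ_sum_single w]
  refine Finset.sum_induction _ C add zero fun p _ => ?_
  rw [(w p).as_sum]
  have h : (Pi.single p (∑ v ∈ (w p).support, monomial v (coeff v (w p))) :
      ι → MvPolynomial V ℂ) =
        ∑ v ∈ (w p).support, coeff v (w p) • Pi.single p (monomial v 1) := by
    rw [← LinearMap.single_apply (R := ℂ), map_sum]
    refine Finset.sum_congr rfl fun v _ => ?_
    rw [monomial_eq_smul_one, map_smul]
    rfl
  rw [h]
  exact Finset.sum_induction _ C add zero fun m _ => smul _ _ (single p m)

/-- The functions on the pairs in `N_{a-b}(X)` that come from homomorphisms `R/R₀ → A_X`. -/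
def IsCocycleTwo (X : Complex V) (a b : Finset V) (l : nSet X a b → nSet X a b → ℂ) : Prop :=
  (∀ f g h : nSet X a b, (f : Finset V) ∪ (g : Finset V) ∪ (h : Finset V) ∈ X →
    l f g + l g h = l f h) ∧
  ∀ f g : nSet X a b, (f : Finset V) ∈ nTilde X a b → (g : Finset V) ∈ nTilde X a b →
    (f : Finset V) ∪ (g : Finset V) ∈ X → l f g = 0

/-- The functions on the pairs in `N_{a-b}(X)` that come from homomorphisms `F → A_X`. -/
def IsCoboundaryTwo (X : Complex V) (a b : Finset V) (l : nSet X a b → nSet X a b → ℂ) : Prop :=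
  ∃ ν : nSet X a b → ℂ, (∀ f : nSet X a b, (f : Finset V) ∈ nTilde X a b → ν f = 0) ∧
    ∀ f g : nSet X a b, (f : Finset V) ∪ (g : Finset V) ∈ X → l f g = ν f - ν g

lemma IsCoboundaryTwo.isCocycleTwo {X : Complex V} {a b : Finset V}
    {l : nSet X a b → nSet X a b → ℂ} (h : IsCoboundaryTwo X a b l) : IsCocycleTwo X a b l := by
  obtain ⟨ν, hν, hl⟩ := h
  refine ⟨fun f g h hX => ?_, fun f g hf hg hX => ?_⟩
  · rw [hl f g (X.down_closed hX Finset.subset_union_left),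
      hl g h (X.down_closed hX (Finset.union_subset_union_left Finset.subset_union_right)),
      hl f h (X.down_closed hX (Finset.union_subset_union_left Finset.subset_union_left))]
    ring
  · rw [hl f g hX, hν f hf, hν g hg, sub_zero]

section Combinatorics

variable {X : Complex V} {a b : Finset V}

/-- The function `(p, q) ↦ l((p ∪ a) ∖ b, (q ∪ a) ∖ b)`. -/
def coeffTwo (l : nSet X a b → nSet X a b → ℂ) (p q : Finset V) : ℂ :=
  open Classical in
  if h : trunc a b p ∈ nSet X a b ∧ trunc a b q ∈ nSet X a b then
    l ⟨trunc a b p, h.1⟩ ⟨trunc a b q, h.2⟩ else 0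

lemma coeffTwo_of_mem (l : nSet X a b → nSet X a b → ℂ) {p q : Finset V}
    (hp : trunc a b p ∈ nSet X a b) (hq : trunc a b q ∈ nSet X a b) :
    coeffTwo l p q = l ⟨trunc a b p, hp⟩ ⟨trunc a b q, hq⟩ := by
  rw [coeffTwo, dif_pos ⟨hp, hq⟩]

variable {l : nSet X a b → nSet X a b → ℂ}

lemma IsCocycleTwo.coeffTwo_add (hab : Disjoint a b) (hl : IsCocycleTwo X a b l)
    {p q r W : Finset V} (hp : p ∉ X) (hq : q ∉ X) (hr : r ∉ X) (hpW : p ⊆ W) (hqW : q ⊆ W)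
    (hrW : r ⊆ W) (hW : trunc a b W ∈ X) :
    coeffTwo l p q + coeffTwo l q r = coeffTwo l p r := by
  have hp' := trunc_mem_nSet hab hp (X.down_closed hW (trunc_mono a b hpW))
  have hq' := trunc_mem_nSet hab hq (X.down_closed hW (trunc_mono a b hqW))
  have hr' := trunc_mem_nSet hab hr (X.down_closed hW (trunc_mono a b hrW))
  rw [coeffTwo_of_mem l hp' hq', coeffTwo_of_mem l hq' hr', coeffTwo_of_mem l hp' hr']
  refine hl.1 _ _ _ (X.down_closed hW ?_)
  simp only [← trunc_union]
  exact trunc_mono a b (Finset.union_subset (Finset.union_subset hpW hqW) hrW)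

lemma IsCocycleTwo.coeffTwo_eq_zero (hl : IsCocycleTwo X a b l)
    {p q : Finset V} (hp : trunc a b p ∈ nTilde X a b) (hq : trunc a b q ∈ nTilde X a b)
    (h : trunc a b (p ∪ q) ∈ X) : coeffTwo l p q = 0 := by
  rw [coeffTwo_of_mem l hp.1 hq.1]
  exact hl.2 _ _ hp hq (by simpa only [← trunc_union] using h)

/-- Both truncations lie in Ñ: that of p because p misses part of b, that of W because it contains
the truncation of U. -/
lemma IsCocycleTwo.coeffTwo_eq_zero_of_not_subset (hab : Disjoint a b)
    (hl : IsCocycleTwo X a b l) {p U W : Finset V} (hp : p ∉ X) (hpU : p ⊆ U) (hUW : U ⊆ W)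
    (hb : ¬ b ⊆ U) (hW : trunc a b W ∈ X) : coeffTwo l p W = 0 := by
  have hUX : U ∉ X := fun h => hp (X.down_closed h hpU)
  have hWX : W ∉ X := fun h => hUX (X.down_closed h hUW)
  have h1 : trunc a b p ∈ nTilde X a b := trunc_mem_nTilde hab hp
    (X.down_closed hW (trunc_mono a b (hpU.trans hUW))) fun h => hb (h.trans hpU)
  have h2 : trunc a b W ∈ nTilde X a b := nTilde_of_subset
    (trunc_mem_nTilde hab hUX (X.down_closed hW (trunc_mono a b hUW)) hb)
    (trunc_mem_nSet hab hWX hW) (trunc_mono a b hUW)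
  exact hl.coeffTwo_eq_zero h1 h2 (by rwa [Finset.union_eq_right.2 (hpU.trans hUW)])

end Combinatorics

section Taylor

variable [Fintype V] {Y : Complex V}

lemma genMap_single (p : {p : Finset V // p ∉ Y}) (m : V →₀ ℕ) :
    genMap (srGen Y) (Pi.single p (monomial m 1)) = monomial (m + sqfreeExp p.1) 1 := by
  rw [genMap, Fintype.linearCombination_apply_single, srGen, sqfree_eq_monomial, smul_eq_mul,
    monomial_mul, one_mul]

/-- The monomial `x^d` as a multiple of the generator given by its support. -/
def monomialLift (Y : Complex V) (d : V →₀ ℕ) : {p : Finset V // p ∉ Y} → MvPolynomial V ℂ :=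
  @dite _ (d.support ∉ Y) (Classical.dec _)
    (fun h => Pi.single ⟨d.support, h⟩ (monomial (d - sqfreeExp d.support) 1)) fun _ => 0

/-- A `ℂ`-linear map `P → F` that is a section of `F → P` over the Stanley-Reisner ideal. -/
def genSection (Y : Complex V) :
    MvPolynomial V ℂ →ₗ[ℂ] ({p : Finset V // p ∉ Y} → MvPolynomial V ℂ) :=
  (basisMonomials V ℂ).constr ℂ (monomialLift Y)

lemma genSection_monomial {d : V →₀ ℕ} (h : d.support ∉ Y) : genSection Y (monomial d 1) =
    (Pi.single ⟨d.support, h⟩ (monomial (d - sqfreeExp d.support) 1) :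
      {p : Finset V // p ∉ Y} → MvPolynomial V ℂ) := by
  have := (basisMonomials V ℂ).constr_basis ℂ (monomialLift Y) d
  rw [coe_basisMonomials] at this
  rw [genSection, this, monomialLift, dif_pos h]

lemma sub_add_sqfreeExp_sdiff (m : V →₀ ℕ) (p : Finset V) :
    m + sqfreeExp p - sqfreeExp (m + sqfreeExp p).support +
      sqfreeExp ((m + sqfreeExp p).support \ p) = m := by
  ext i
  simp only [Finsupp.add_apply, Finsupp.tsub_apply, sqfreeExp_apply, Finset.mem_sdiff,
    Finsupp.mem_support_iff]
  by_cases hi : i ∈ p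
  · simp [hi]
  · by_cases hm : m i = 0
    · simp [hi, hm]
    · simp only [hi, if_false, add_zero, ne_eq, hm, not_false_eq_true, if_true, and_true]
      omega

/-- The Taylor relations generate R. Modulo them x^m e_p can be moved to the generator of the full
support of x^{m+p}, which depends only on the image in P; hence an element of R is congruent to the
section of 0. -/
lemma sub_genSection_mem (K : Submodule (MvPolynomial V ℂ) (relations (srGen Y)))
    (hK : ∀ p q, taylorRel Y p q ∈ K) (w : {p : Finset V // p ∉ Y} → MvPolynomial V ℂ) :
    w - genSection Y (genMap (srGen Y) w) ∈ K.map (relations (srGen Y)).subtype := by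
  induction w using free_induction with
  | zero => simp
  | add w w' h h' =>
    have := Submodule.add_mem _ h h'
    rwa [sub_add_sub_comm, ← map_add, ← map_add] at this
  | smul r w h =>
    have := Submodule.smul_mem _ (C r : MvPolynomial V ℂ) h
    have hC : ∀ v : {p : Finset V // p ∉ Y} → MvPolynomial V ℂ,
        (C r : MvPolynomial V ℂ) • v = r • v := fun v => by
      ext1 p
      rw [Pi.smul_apply, Pi.smul_apply, smul_eq_mul, smul_eq_C_mul]
    rwa [hC, smul_sub, ← LinearMap.map_smul (genSection Y),
      ← LinearMap.map_smul_of_tower (genMap (srGen Y)) r w] at this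
  | single p m =>
    rw [genMap_single]
    set d := m + sqfreeExp p.1 with hd
    have hps : p.1 ⊆ d.support := by
      rw [← sqfreeExp_le_iff]
      exact le_add_self
    have hs : d.support ∉ Y := fun h => p.2 (Y.down_closed h hps)
    rw [genSection_monomial hs]
    refine ⟨monomial (d - sqfreeExp d.support) (1 : ℂ) • taylorRel Y p ⟨d.support, hs⟩,
      K.smul_mem _ (hK _ _), ?_⟩
    have h1 : (monomial (d - sqfreeExp d.support) (1 : ℂ)) * sqfree (d.support \ p.1) =
        monomial m 1 := by
      rw [sqfree_eq_monomial, monomial_mul, one_mul]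
      rw [hd, sub_add_sqfreeExp_sdiff]
    have h2 : sqfree (p.1 \ d.support) = 1 := by
      rw [Finset.sdiff_eq_empty_iff_subset.2 hps]
      rfl
    simp only [taylorRel, map_smul, Submodule.subtype_apply, h2, smul_sub]
    congr 1
    · rw [← Pi.single_smul', smul_eq_mul, h1]
    · rw [← Pi.single_smul', smul_eq_mul, mul_one]

lemma relHom_ext {ψ ψ' : RelHom (srGen Y)}
    (h : ∀ p q, ψ (Submodule.Quotient.mk (taylorRel Y p q)) =
      ψ' (Submodule.Quotient.mk (taylorRel Y p q))) : ψ = ψ' := by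
  refine LinearMap.ext fun r => ?_
  obtain ⟨r, rfl⟩ := Submodule.Quotient.mk_surjective _ r
  have := sub_genSection_mem (LinearMap.ker ((ψ - ψ') ∘ₗ (koszul (srGen Y)).mkQ))
    (fun p q => by
      rw [LinearMap.mem_ker, LinearMap.comp_apply, Submodule.mkQ_apply, LinearMap.sub_apply, h,
        sub_self]) r.1
  rw [LinearMap.mem_ker.1 r.2, map_zero, sub_zero] at this
  obtain ⟨r', hr', hrr⟩ := this
  rw [Subtype.ext hrr, SetLike.mem_coe, LinearMap.mem_ker, LinearMap.comp_apply, Submodule.mkQ_apply, LinearMap.sub_apply,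
    sub_eq_zero] at hr'
  exact hr'

end Taylor

section HomTwo

variable [Fintype V] {Y : Complex V} {α : V →₀ ℕ} {b : Finset V}

/-- Auxiliary `ℂ`-linear map `P → A_X`, the component at `e_p` of `preHomTwo`. -/
def preHomTwoAt (l : nSet Y α.support b → nSet Y α.support b → ℂ) (p : Finset V) :
    MvPolynomial V ℂ →ₗ[ℂ] srRing Y :=
  (basisMonomials V ℂ).constr ℂ fun m =>
    coeffTwo l p (m + sqfreeExp p).support •
      ringMonomial Y (degOf (m + sqfreeExp p) + degSub α b)

lemma preHomTwoAt_monomial (l : nSet Y α.support b → nSet Y α.support b → ℂ) (p : Finset V)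
    (m : V →₀ ℕ) : preHomTwoAt l p (monomial m 1) =
      coeffTwo l p (m + sqfreeExp p).support •
        ringMonomial Y (degOf (m + sqfreeExp p) + degSub α b) := by
  have := (basisMonomials V ℂ).constr_basis ℂ (fun m =>
    coeffTwo l p (m + sqfreeExp p).support •
      ringMonomial Y (degOf (m + sqfreeExp p) + degSub α b)) m
  rwa [coe_basisMonomials] at this

/-- Auxiliary `ℂ`-linear map `F → A_X`, `x^m e_p ↦ l(f, h) x^{m+p+𝐚-b}`, where
`f = (p ∪ a) ∖ b` and `h = (supp (m + p) ∪ a) ∖ b`. -/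
def preHomTwo (l : nSet Y α.support b → nSet Y α.support b → ℂ) :
    ({p : Finset V // p ∉ Y} → MvPolynomial V ℂ) →ₗ[ℂ] srRing Y :=
  ∑ p, preHomTwoAt l p.1 ∘ₗ LinearMap.proj p

lemma preHomTwo_apply (l : nSet Y α.support b → nSet Y α.support b → ℂ)
    (w : {p : Finset V // p ∉ Y} → MvPolynomial V ℂ) :
    preHomTwo l w = ∑ p, preHomTwoAt l p.1 (w p) := by
  simp [preHomTwo]

lemma preHomTwo_single (l : nSet Y α.support b → nSet Y α.support b → ℂ)
    (p : {p : Finset V // p ∉ Y}) (f : MvPolynomial V ℂ) :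
    preHomTwo l (Pi.single p f) = preHomTwoAt l p.1 f := by
  rw [preHomTwo_apply, Finset.sum_eq_single p, Pi.single_eq_same]
  · intro q _ hq
    rw [Pi.single_eq_of_ne hq, map_zero]
  · exact fun h => absurd (Finset.mem_univ p) h

/-- The defect of linearity of `preHomTwo`, as a map on the image of `F → P`. -/
def preHomTwoDefect (l : nSet Y α.support b → nSet Y α.support b → ℂ) (i : V) :
    MvPolynomial V ℂ →ₗ[ℂ] srRing Y :=
  (basisMonomials V ℂ).constr ℂ fun d =>
    (if b ⊆ d.support then coeffTwo l d.support (Finsupp.single i 1 + d).support else 0) •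
      ringMonomial Y (degOf (Finsupp.single i 1 + d) + degSub α b)

lemma preHomTwoDefect_monomial (l : nSet Y α.support b → nSet Y α.support b → ℂ) (i : V)
    (d : V →₀ ℕ) : preHomTwoDefect l i (monomial d 1) =
    (if b ⊆ d.support then coeffTwo l d.support (Finsupp.single i 1 + d).support else 0) •
      ringMonomial Y (degOf (Finsupp.single i 1 + d) + degSub α b) := by
  have := (basisMonomials V ℂ).constr_basis ℂ (fun d =>
    (if b ⊆ d.support then coeffTwo l d.support (Finsupp.single i 1 + d).support else 0) •
      ringMonomial Y (degOf (Finsupp.single i 1 + d) + degSub α b)) d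
  rwa [coe_basisMonomials] at this

/-- The map is not P-linear on F. By the cocycle identity the error made in passing from x^d to x_i
x^d depends only on d = m + p and not on p, so it factors through F → P and disappears on R. -/
lemma preHomTwo_X_smul (hab : Disjoint α.support b)
    {l : nSet Y α.support b → nSet Y α.support b → ℂ} (hl : IsCocycleTwo Y α.support b l) (i : V)
    (w : {p : Finset V // p ∉ Y} → MvPolynomial V ℂ) :
    preHomTwo l ((X i : MvPolynomial V ℂ) • w) = (X i : MvPolynomial V ℂ) • preHomTwo l w +
      preHomTwoDefect l i (genMap (srGen Y) w) := by
  induction w using free_induction with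
  | zero => simp
  | add w w' h h' =>
    rw [smul_add, map_add, map_add, map_add, map_add, h, h', smul_add, add_add_add_comm]
  | smul r w h =>
    have hC : genMap (srGen Y) (r • w) = r • genMap (srGen Y) w :=
      LinearMap.map_smul_of_tower (genMap (srGen Y)) r w
    rw [smul_comm, hC, LinearMap.map_smul (preHomTwo l), LinearMap.map_smul (preHomTwo l),
      LinearMap.map_smul (preHomTwoDefect l i), h, smul_add, smul_comm]
  | single p m =>
    have h1 : (X i : MvPolynomial V ℂ) • (Pi.single p (monomial m 1) :
        {p : Finset V // p ∉ Y} → MvPolynomial V ℂ) =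
          Pi.single p (monomial (Finsupp.single i 1 + m) 1) := by
      rw [← Pi.single_smul', X, smul_eq_mul, monomial_mul, one_mul]
    rw [genMap_single, h1, preHomTwo_single, preHomTwo_single, preHomTwoAt_monomial,
      preHomTwoAt_monomial, preHomTwoDefect_monomial, add_assoc]
    set d := m + sqfreeExp p.1 with hd
    have hps : p.1 ⊆ d.support := by
      rw [← sqfreeExp_le_iff]
      exact le_add_self
    have hdX : d.support ∉ Y := fun h => p.2 (Y.down_closed h hps)
    have h2 : d.support ⊆ (Finsupp.single i 1 + d).support := by
      intro j hj
      simp only [Finsupp.mem_support_iff, Finsupp.add_apply] at hj ⊢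
      omega
    have hdX' : (Finsupp.single i 1 + d).support ∉ Y := fun h => hdX (Y.down_closed h h2)
    rw [smul_comm]
    by_cases hb : b ⊆ d.support
    · rw [X_smul_ringMonomial hab Y hb, if_pos hb, ← add_smul]
      by_cases h0 : ringMonomial Y (degOf (Finsupp.single i 1 + d) + degSub α b) = 0
      · rw [h0, smul_zero, smul_zero]
      · obtain ⟨h4, h5⟩ := of_ringMonomial_ne_zero hab h0
        rw [hl.coeffTwo_add hab p.2 hdX hdX' (hps.trans h2) h2 subset_rfl h5]
    -- Here x^{d+𝐚-b} is 0, while multiplication by x_i may repair the negative exponent. The scalar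
    -- in front of the new monomial then vanishes because both faces lie in Ñ.
    · rw [if_neg hb, zero_smul, add_zero, ringMonomial_of_not_nonneg Y
        (mt (degOf_add_degSub_nonneg hab d).1 hb), smul_zero, smul_zero]
      by_cases h0 : ringMonomial Y (degOf (Finsupp.single i 1 + d) + degSub α b) = 0
      · rw [h0, smul_zero]
      · obtain ⟨h4, h5⟩ := of_ringMonomial_ne_zero hab h0
        rw [hl.coeffTwo_eq_zero_of_not_subset hab p.2 hps h2 hb h5, zero_smul]

/-- This is the vanishing on Koszul relations, whose degree D is at least p + q. If b ⊆ p,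
subtracting b would still leave q in the support of x^{D+𝐚-b}, which is a face; likewise with p and
q exchanged. So neither contains b, both truncations lie in Ñ, and λ is 0 on the pair. -/
lemma coeffTwo_eq_of_add_le (hab : Disjoint α.support b)
    {l : nSet Y α.support b → nSet Y α.support b → ℂ} (hl : IsCocycleTwo Y α.support b l)
    {p q : Finset V} (hp : p ∉ Y) (hq : q ∉ Y) {D : V →₀ ℕ} (hD : sqfreeExp p + sqfreeExp q ≤ D)
    (h0 : ringMonomial Y (degOf D + degSub α b) ≠ 0) :
    coeffTwo l p D.support = coeffTwo l q D.support := by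
  obtain ⟨hbD, hDX⟩ := of_ringMonomial_ne_zero hab h0
  obtain ⟨m, hm⟩ := exists_degOf_eq ((degOf_add_degSub_nonneg hab D).2 hbD)
  rw [← hm, Ne, ringMonomial_degOf_eq_zero_iff, not_not] at h0
  have hpD : p ⊆ D.support := (sqfreeExp_le_iff _ _).1 (le_self_add.trans hD)
  have hqD : q ⊆ D.support := (sqfreeExp_le_iff _ _).1 (le_add_self.trans hD)
  have hDY : D.support ∉ Y := fun h => hp (Y.down_closed h hpD)
  have key : ∀ s t : Finset V, t ∉ Y → sqfreeExp s + sqfreeExp t ≤ D → ¬ b ⊆ s := by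
    intro s t ht hst hbs
    refine ht (Y.down_closed h0 fun i hi => ?_)
    have h1 := hst i
    have h2 := congrFun hm i
    have h3 := @hbs i
    simp only [Finsupp.add_apply, sqfreeExp_apply, hi, if_true] at h1
    simp only [degOf, degSub, charVec, Pi.add_apply] at h2
    rw [Finsupp.mem_support_iff]
    by_cases hib : i ∈ b
    · simp only [hib, h3 hib, if_true] at h1 h2
      omega
    · simp only [hib, if_false] at h2
      omega
  have hpq : trunc α.support b (p ∪ q) ∈ Y :=
    Y.down_closed hDX (trunc_mono _ _ (Finset.union_subset hpD hqD))
  have h1 := hl.coeffTwo_add hab hp hq hDY hpD hqD subset_rfl hDX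
  rwa [hl.coeffTwo_eq_zero
    (trunc_mem_nTilde hab hp (Y.down_closed hDX (trunc_mono _ _ hpD)) (key p q hq hD))
    (trunc_mem_nTilde hab hq (Y.down_closed hDX (trunc_mono _ _ hqD))
      (key q p hp (by rwa [add_comm]))) hpq, zero_add, eq_comm] at h1

lemma preHomTwo_koszul (hab : Disjoint α.support b)
    {l : nSet Y α.support b → nSet Y α.support b → ℂ} (hl : IsCocycleTwo Y α.support b l)
    (e f : {p : Finset V // p ∉ Y} → MvPolynomial V ℂ) :
    preHomTwo l (genMap (srGen Y) f • e - genMap (srGen Y) e • f) = 0 := by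
  have hC : ∀ (r : ℂ) (w : {p : Finset V // p ∉ Y} → MvPolynomial V ℂ),
      genMap (srGen Y) (r • w) = r • genMap (srGen Y) w :=
    fun r w => LinearMap.map_smul_of_tower (genMap (srGen Y)) r w
  induction e using free_induction with
  | zero => simp
  | add w w' h h' =>
    rw [smul_add, map_add, add_smul, add_sub_add_comm, map_add, h, h', add_zero]
  | smul r w h =>
    rw [smul_comm, hC, smul_assoc, ← smul_sub, LinearMap.map_smul (preHomTwo l), h, smul_zero]
  | single p m =>
  induction f using free_induction with
  | zero => simp
  | add w w' h h' =>
    rw [smul_add, map_add, add_smul, add_sub_add_comm, map_add, h, h', add_zero]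
  | smul r w h =>
    rw [smul_comm, hC, smul_assoc, ← smul_sub, LinearMap.map_smul (preHomTwo l), h, smul_zero]
  | single q k =>
    rw [genMap_single, genMap_single, ← Pi.single_smul', ← Pi.single_smul', map_sub,
      preHomTwo_single, preHomTwo_single, smul_eq_mul, smul_eq_mul, monomial_mul, monomial_mul,
      one_mul, preHomTwoAt_monomial, preHomTwoAt_monomial]
    have h1 : m + sqfreeExp p.1 + k + sqfreeExp q.1 = k + sqfreeExp q.1 + m + sqfreeExp p.1 := by
      abel
    rw [h1, ← sub_smul]
    by_cases h0 : ringMonomial Y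
        (degOf (k + sqfreeExp q.1 + m + sqfreeExp p.1) + degSub α b) = 0
    · rw [h0, smul_zero]
    · rw [coeffTwo_eq_of_add_le hab hl p.2 q.2 _ h0, sub_self, zero_smul]
      intro i
      simp only [Finsupp.add_apply]
      omega

/-- The homomorphism `R/R₀ → A_X` of degree `𝐚 - b` defined by a function on the pairs in
`N_{a-b}(X)`. -/
def homTwo (hab : Disjoint α.support b) {l : nSet Y α.support b → nSet Y α.support b → ℂ}
    (hl : IsCocycleTwo Y α.support b l) : RelHom (srGen Y) :=
  (koszul (srGen Y)).liftQ
    (restrictOfXSMul (relations (srGen Y)) (preHomTwo l) fun i w hw => by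
      rw [preHomTwo_X_smul hab hl, LinearMap.mem_ker.1 hw, map_zero, add_zero])
    (Submodule.span_le.2 (by
      rintro ⟨r, hr⟩ ⟨e, f, rfl⟩
      exact preHomTwo_koszul hab hl e f))

lemma homTwo_mk (hab : Disjoint α.support b) {l : nSet Y α.support b → nSet Y α.support b → ℂ}
    (hl : IsCocycleTwo Y α.support b l) (r : relations (srGen Y)) :
    homTwo hab hl (Submodule.Quotient.mk r) = preHomTwo l r := rfl

lemma homTwo_mem (hab : Disjoint α.support b) {l : nSet Y α.support b → nSet Y α.support b → ℂ}
    (hl : IsCocycleTwo Y α.support b l) : homTwo hab hl ∈ relHomPiece Y (degSub α b) := by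
  intro D r hr
  rw [homTwo_mk, preHomTwo_apply]
  refine Submodule.sum_mem _ fun p _ => ?_
  have hp := mem_polyPiece.1 (hr p)
  rw [(r.1 p).as_sum, map_sum]
  refine Submodule.sum_mem _ fun m hm => ?_
  rw [monomial_eq_smul_one, map_smul, preHomTwoAt_monomial, degOf_add, degOf_sqfreeExp,
    hp m (mem_support_iff.1 hm), sub_add_cancel]
  exact Submodule.smul_mem _ _ (mem_ringPiece.2 ⟨_, rfl⟩)

/-- The two terms contribute the scalars of (p, p ∪ q) and (q, p ∪ q); the cocycle identity turns
their difference into that of (p, q). -/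
lemma homTwo_taylorRel (hab : Disjoint α.support b)
    {l : nSet Y α.support b → nSet Y α.support b → ℂ}
    (hl : IsCocycleTwo Y α.support b l) (p q : {p : Finset V // p ∉ Y}) :
    homTwo hab hl (Submodule.Quotient.mk (taylorRel Y p q)) =
      coeffTwo l p.1 q.1 • ringMonomial Y (charVec (p.1 ∪ q.1) + degSub α b) := by
  have h1 : ∀ s t : Finset V, sqfreeExp (t \ s) + sqfreeExp s = sqfreeExp (s ∪ t) := by
    intro s t
    ext i
    simp only [Finsupp.add_apply, sqfreeExp_apply, Finset.mem_sdiff, Finset.mem_union]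
    by_cases hs : i ∈ s <;> by_cases ht : i ∈ t <;> simp [hs, ht]
  rw [homTwo_mk, taylorRel, map_sub, preHomTwo_single, preHomTwo_single, sqfree_eq_monomial,
    sqfree_eq_monomial, preHomTwoAt_monomial, preHomTwoAt_monomial, h1, h1,
    Finset.union_comm q.1 p.1, support_sqfreeExp, degOf_sqfreeExp, ← sub_smul]
  by_cases h0 : ringMonomial Y (charVec (p.1 ∪ q.1) + degSub α b) = 0
  · rw [h0, smul_zero, smul_zero]
  · rw [← hl.coeffTwo_add hab p.2 q.2 (r := p.1 ∪ q.1)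
      (fun h => p.2 (Y.down_closed h Finset.subset_union_left)) Finset.subset_union_left
      Finset.subset_union_right subset_rfl ((ringMonomial_ne_zero_iff hab).1 h0).2,
      add_sub_cancel_right]

lemma homTwo_represents (hab : Disjoint α.support b)
    {l : nSet Y α.support b → nSet Y α.support b → ℂ}
    (hl : IsCocycleTwo Y α.support b l) :
    RepresentsTwo Y α b l (Submodule.Quotient.mk (homTwo hab hl)) := by
  refine ⟨_, homTwo_mem hab hl, rfl, fun p q f g hf hg _ => ?_⟩
  have hft : trunc α.support b p.1 = f := hf.symm
  have hgt : trunc α.support b q.1 = g := hg.symm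
  rw [homTwo_taylorRel, coeffTwo_of_mem l (hft ▸ f.2) (hgt ▸ g.2)]
  congr 2
  · exact Subtype.ext hft
  · exact Subtype.ext hgt

end HomTwo

end

/-! ### From homomorphisms on relations back to cocycles; trivial classes in T² -/

section

variable {V : Type*} [DecidableEq V]

/-- The combinatorial properties of the coefficients of a homomorphism `R/R₀ → A_X` on the
relations `R_{p,q}`. -/
structure IsRelCoeff (X : Complex V) (a b : Finset V)
    (μ : {p : Finset V // p ∉ X} → {p : Finset V // p ∉ X} → ℂ) : Prop where
  zero : ∀ p q, ¬ b ⊆ p.1 ∪ q.1 → μ p q = 0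
  cocycle : ∀ p q r (W : Finset V), p.1 ⊆ W → q.1 ⊆ W → r.1 ⊆ W → b ⊆ W → trunc a b W ∈ X →
    μ p q + μ q r = μ p r
  koszul : ∀ p q, b ⊆ p.1 ∪ q.1 → trunc a b (p.1 ∪ q.1) ∪ (p.1 ∩ q.1 ∩ b) ∈ X → μ p q = 0

namespace IsRelCoeff

variable {X : Complex V} {a b : Finset V}
  {μ : {p : Finset V // p ∉ X} → {p : Finset V // p ∉ X} → ℂ}

/-- If the truncation of p ∪ q together with p ∩ q ∩ b is a face, the Koszul relation applies. If
not, it is a non-face to interpose between p and q: its union with either of them still misses part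
of b, so both intermediate scalars vanish for degree reasons. -/
lemma eq_zero_of_not_subset (hμ : IsRelCoeff X a b μ) (hab : Disjoint a b)
    {p q : {p : Finset V // p ∉ X}} (hp : ¬ b ⊆ p.1) (hq : ¬ b ⊆ q.1)
    (h : trunc a b (p.1 ∪ q.1) ∈ X) : μ p q = 0 := by
  by_cases hb : b ⊆ p.1 ∪ q.1
  · by_cases hk : trunc a b (p.1 ∪ q.1) ∪ (p.1 ∩ q.1 ∩ b) ∈ X
    · exact hμ.koszul p q hb hk
    · have hnot : ∀ s : Finset V, p.1 ∩ q.1 ⊆ s → ¬ b ⊆ s →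
          ¬ b ⊆ s ∪ (trunc a b (p.1 ∪ q.1) ∪ (p.1 ∩ q.1 ∩ b)) := by
        intro s hs hbs hsub
        refine hbs fun i hi => ?_
        have h1 := hsub hi
        have h2 := @hs i
        simp only [trunc, Finset.mem_union, Finset.mem_sdiff, Finset.mem_inter] at h1 h2
        tauto
      have hW : trunc a b (p.1 ∪ q.1) ∪ b ∉ X ∧
          trunc a b (trunc a b (p.1 ∪ q.1) ∪ b) = trunc a b (p.1 ∪ q.1) := by
        have hN := trunc_mem_nSet hab
          (fun h' => p.2 (X.down_closed h' Finset.subset_union_left)) h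
        exact ⟨hN.2.2.2, trunc_union_self hN⟩
      have h1 := hμ.cocycle p ⟨_, hk⟩ q (trunc a b (p.1 ∪ q.1) ∪ b)
        (by intro i hi; simp only [trunc, Finset.mem_union, Finset.mem_sdiff]; tauto)
        (Finset.union_subset_union_right Finset.inter_subset_right)
        (by intro i hi; simp only [trunc, Finset.mem_union, Finset.mem_sdiff]; tauto)
        Finset.subset_union_right (by rwa [hW.2])
      rw [hμ.zero p ⟨_, hk⟩ (hnot _ Finset.inter_subset_left hp),
        hμ.zero ⟨_, hk⟩ q (by
          rw [Finset.union_comm]; exact hnot _ Finset.inter_subset_right hq), zero_add] at h1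
      exact h1.symm
  · exact hμ.zero p q hb

lemma diag (hμ : IsRelCoeff X a b μ) {p : {p : Finset V // p ∉ X}} (hb : b ⊆ p.1)
    (h : trunc a b p.1 ∈ X) : μ p p = 0 := by
  simpa using hμ.cocycle p p p p.1 subset_rfl subset_rfl subset_rfl hb h

end IsRelCoeff

lemma subset_trunc_union_self (a b p : Finset V) : p ⊆ trunc a b p ∪ b :=
  (subset_trunc_union a b p).trans (Finset.union_subset_union_right Finset.inter_subset_right)

namespace IsRelCoeff

variable {X : Complex V} {a b : Finset V}
  {μ : {p : Finset V // p ∉ X} → {p : Finset V // p ∉ X} → ℂ}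

lemma apply_nonface_eq (hμ : IsRelCoeff X a b μ) (hab : Disjoint a b)
    {p q : {p : Finset V // p ∉ X}} (hp : ¬ b ⊆ p.1) (hq : ¬ b ⊆ q.1) {f : nSet X a b}
    (hpf : trunc a b p.1 = f) (hqf : trunc a b q.1 = f) :
    μ p (nonface f) = μ q (nonface f) := by
  have hf : trunc a b (f.1 ∪ b) ∈ X := by rw [trunc_union_self f.2]; exact f.2.1
  rw [← hμ.cocycle p q (nonface f) (f.1 ∪ b) (hpf ▸ subset_trunc_union_self a b p.1)
    (hqf ▸ subset_trunc_union_self a b q.1) subset_rfl Finset.subset_union_right hf,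
    hμ.eq_zero_of_not_subset hab hp hq, zero_add]
  rw [trunc_union, hpf, hqf, Finset.union_self]
  exact f.2.1

/-- If p misses part of b, homomorphisms F → A_X of this degree vanish on e_p and cannot alter the
scalar there. It is therefore essential that this scalar depends only on f. -/
lemma exists_normalizer (hμ : IsRelCoeff X a b μ) (hab : Disjoint a b) :
    ∃ κ : nSet X a b → ℂ, ∀ (p : {p : Finset V // p ∉ X}) (f : nSet X a b),
      trunc a b p.1 = f → ¬ b ⊆ p.1 → μ p (nonface f) = κ f := by
  classical
  refine ⟨fun f => if h : ∃ p : {p : Finset V // p ∉ X}, trunc a b p.1 = f ∧ ¬ b ⊆ p.1 then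
    μ h.choose (nonface f) else 0, fun p f hpf hp => ?_⟩
  have h : ∃ p : {p : Finset V // p ∉ X}, trunc a b p.1 = f ∧ ¬ b ⊆ p.1 := ⟨p, hpf, hp⟩
  dsimp only
  rw [dif_pos h]
  exact hμ.apply_nonface_eq hab hp h.choose_spec.2 hpf h.choose_spec.1

/-- All of p, q, f ∪ b, g ∪ b lie in f ∪ g ∪ b, where the cocycle identity is available. -/
lemma eq_add_sub (hμ : IsRelCoeff X a b μ)
    {p q : {p : Finset V // p ∉ X}} {f g : nSet X a b} (hpf : trunc a b p.1 = f)
    (hqg : trunc a b q.1 = g) (h : f.1 ∪ g.1 ∈ X) :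
    μ p q = μ p (nonface f) + μ (nonface f) (nonface g) - μ q (nonface g) := by
  have hN := union_mem_nSet f.2 g.2 h
  have hW : trunc a b (f.1 ∪ g.1 ∪ b) ∈ X := by
    rw [trunc_union_self hN]; exact h
  have hf : f.1 ∪ b ⊆ f.1 ∪ g.1 ∪ b := Finset.union_subset_union_left Finset.subset_union_left
  have hg : g.1 ∪ b ⊆ f.1 ∪ g.1 ∪ b := Finset.union_subset_union_left Finset.subset_union_right
  have hp : p.1 ⊆ f.1 ∪ g.1 ∪ b := Finset.Subset.trans (hpf ▸ subset_trunc_union_self a b p.1) hf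
  have hq : q.1 ⊆ f.1 ∪ g.1 ∪ b := Finset.Subset.trans (hqg ▸ subset_trunc_union_self a b q.1) hg
  have hb : b ⊆ f.1 ∪ g.1 ∪ b := Finset.subset_union_right
  have h1 := hμ.cocycle p q (nonface g) _ hp hq hg hb hW
  have h2 := hμ.cocycle p (nonface f) (nonface g) _ hp hf hg hb hW
  rw [h2, ← h1, add_sub_cancel_right]

/-- If `l` describes all coefficients `μ`, it is a cocycle. -/
lemma isCocycleTwo (hμ : IsRelCoeff X a b μ) (hab : Disjoint a b)
    {l : nSet X a b → nSet X a b → ℂ}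
    (h : ∀ p q (f g : nSet X a b), trunc a b p.1 = f → trunc a b q.1 = g → f.1 ∪ g.1 ∈ X →
      b ⊆ p.1 ∪ q.1 → μ p q = l f g) : IsCocycleTwo X a b l := by
  have hn : ∀ f g : nSet X a b, f.1 ∪ g.1 ∈ X → μ (nonface f) (nonface g) = l f g :=
    fun f g hfg => h _ _ f g (trunc_union_self f.2) (trunc_union_self g.2) hfg
      (Finset.subset_union_right.trans Finset.subset_union_left)
  have htr : ∀ f : nSet X a b, trunc a b (nonface f).1 = f.1 := fun f => trunc_union_self f.2
  constructor
  · intro f g k hX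
    rw [← hn f g (X.down_closed hX Finset.subset_union_left),
      ← hn g k (X.down_closed hX (Finset.union_subset_union_left Finset.subset_union_right)),
      ← hn f k (X.down_closed hX (Finset.union_subset_union_left Finset.subset_union_left))]
    refine hμ.cocycle _ _ _ ((nonface f).1 ∪ (nonface g).1 ∪ (nonface k).1)
      (Finset.subset_union_left.trans Finset.subset_union_left)
      (Finset.subset_union_right.trans Finset.subset_union_left) Finset.subset_union_right
      (Finset.Subset.trans Finset.subset_union_right Finset.subset_union_right) ?_
    rw [trunc_union, trunc_union, htr, htr, htr]
    exact hX
  · rintro f g ⟨-, b₁, hb₁, h₁⟩ ⟨-, b₂, hb₂, h₂⟩ hX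
    have hnot : ∀ (f : nSet X a b) (b' : Finset V), b' ⊂ b → ¬ b ⊆ f.1 ∪ b' := by
      intro f b' hb' hb
      refine hb'.2 fun i hi => (Finset.mem_union.1 (hb hi)).resolve_left fun hif => ?_
      exact Finset.disjoint_left.1 (Finset.disjoint_iff_inter_eq_empty.2 f.2.2.2.1) hif hi
    -- Both non-faces truncate to f, so this scalar is λ(f,f), which is also the diagonal value at f
    -- ∪ b and hence 0.
    have hτ : ∀ (f : nSet X a b) (b' : Finset V) (hb' : b' ⊂ b) (h' : f.1 ∪ b' ∉ X),
        μ ⟨f.1 ∪ b', h'⟩ (nonface f) = 0 := by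
      intro f b' hb' h'
      have hff : f.1 ∪ f.1 ∈ X := by rw [Finset.union_self]; exact f.2.1
      rw [h ⟨f.1 ∪ b', h'⟩ (nonface f) f f (trunc_union_subset f.2 hb'.1) (htr f) hff
        (Finset.Subset.trans Finset.subset_union_right Finset.subset_union_right), ← hn f f hff]
      exact hμ.diag Finset.subset_union_right (by rw [htr]; exact f.2.1)
    have h3 := hμ.eq_add_sub (p := ⟨f.1 ∪ b₁, h₁⟩) (q := ⟨g.1 ∪ b₂, h₂⟩)
      (trunc_union_subset f.2 hb₁.1) (trunc_union_subset g.2 hb₂.1) hX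
    rw [hτ f b₁ hb₁, hτ g b₂ hb₂, zero_add, sub_zero, hn f g hX,
      hμ.eq_zero_of_not_subset hab (hnot f b₁ hb₁) (hnot g b₂ hb₂)] at h3
    · exact h3.symm
    · rw [trunc_union, trunc_union_subset f.2 hb₁.1, trunc_union_subset g.2 hb₂.1]
      exact hX

end IsRelCoeff

section HomTwo

variable [Fintype V] {Y : Complex V} {α : V →₀ ℕ} {b : Finset V}

lemma sqfree_mul_sqfree_sdiff {s t W : Finset V} (hs : s ⊆ W) (ht : t ⊆ W) :
    sqfree (W \ (s ∪ t)) * sqfree (t \ s) = sqfree (W \ s) := by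
  rw [← sqfree_sdiff_mul (Finset.sdiff_subset_sdiff ht (subset_refl s))]
  congr 2
  ext i
  have := @hs i
  simp only [Finset.mem_sdiff, Finset.mem_union]
  tauto

lemma sqfree_smul_taylorRel {p q : {p : Finset V // p ∉ Y}} {W : Finset V} (hp : p.1 ⊆ W)
    (hq : q.1 ⊆ W) : ((sqfree (W \ (p.1 ∪ q.1)) • taylorRel Y p q : relations (srGen Y)) :
      {p : Finset V // p ∉ Y} → MvPolynomial V ℂ) =
        Pi.single p (sqfree (W \ p.1)) - Pi.single q (sqfree (W \ q.1)) := by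
  rw [Submodule.coe_smul, taylorRel, smul_sub, ← Pi.single_smul', ← Pi.single_smul', smul_eq_mul,
    smul_eq_mul, sqfree_mul_sqfree_sdiff hp hq, Finset.union_comm p.1 q.1,
    sqfree_mul_sqfree_sdiff hq hp]

lemma sqfree_smul_taylorRel_add {p q r : {p : Finset V // p ∉ Y}} {W : Finset V} (hp : p.1 ⊆ W)
    (hq : q.1 ⊆ W) (hr : r.1 ⊆ W) :
    sqfree (W \ (p.1 ∪ q.1)) • taylorRel Y p q + sqfree (W \ (q.1 ∪ r.1)) • taylorRel Y q r =
      sqfree (W \ (p.1 ∪ r.1)) • taylorRel Y p r := by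
  refine Subtype.ext ?_
  rw [Submodule.coe_add, sqfree_smul_taylorRel hp hq, sqfree_smul_taylorRel hq hr,
    sqfree_smul_taylorRel hp hr, sub_add_sub_cancel]

/-- The multiple is j(e_q) e_p - j(e_p) e_q. -/
lemma sqfree_inter_smul_taylorRel_mem (p q : {p : Finset V // p ∉ Y}) :
    sqfree (p.1 ∩ q.1) • taylorRel Y p q ∈ koszul (srGen Y) := by
  have h : ∀ s t : Finset V, sqfree (s ∩ t) * sqfree (t \ s) = sqfree t := by
    intro s t
    rw [mul_comm, ← Finset.sdiff_inter_self_right t s, Finset.inter_comm s t]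
    exact sqfree_sdiff_mul Finset.inter_subset_left
  refine Submodule.subset_span ⟨Pi.single p 1, Pi.single q 1, ?_⟩
  rw [Submodule.coe_smul, taylorRel, smul_sub, ← Pi.single_smul', ← Pi.single_smul',
    Fintype.linearCombination_apply_single, Fintype.linearCombination_apply_single,
    ← Pi.single_smul', ← Pi.single_smul', smul_eq_mul, smul_eq_mul, h, Finset.inter_comm, h]
  simp [srGen]

lemma taylorRel_isHomogeneous (p q : {p : Finset V // p ∉ Y}) :
    IsHomogeneousOfDeg Y (charVec (p.1 ∪ q.1)) (taylorRel Y p q).1 := by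
  have h : ∀ p q r : {p : Finset V // p ∉ Y},
      (Pi.single p (sqfree (q.1 \ p.1)) : {p : Finset V // p ∉ Y} → MvPolynomial V ℂ) r ∈
        polyPiece (charVec (p.1 ∪ q.1) - charVec r.1) := by
    intro p q r
    by_cases hr : r = p
    · subst hr
      have h1 : charVec (r.1 ∪ q.1) - charVec r.1 = charVec (q.1 \ r.1) := by
        ext i
        simp only [Pi.sub_apply, charVec, Finset.mem_union, Finset.mem_sdiff]
        by_cases h1 : i ∈ r.1 <;> by_cases h2 : i ∈ q.1 <;> simp [h1, h2]
      rw [Pi.single_eq_same, h1]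
      exact sqfree_mem_polyPiece _
    · rw [Pi.single_eq_of_ne hr]
      exact Submodule.zero_mem _
  intro r
  refine Submodule.sub_mem _ (h p q r) ?_
  rw [Finset.union_comm]
  exact h q p r

/-- Scalars in front of monomials with negative exponents are arbitrary and are set to 0. The
cocycle identity comes from R_{p,q} + R_{q,r} = R_{p,r} after multiplication up to the common degree
W, and the Koszul condition from x^{p ∩ q} R_{p,q} ∈ R₀. -/
lemma exists_isRelCoeff (hab : Disjoint α.support b) {ψ : RelHom (srGen Y)}
    (hψ : ψ ∈ relHomPiece Y (degSub α b)) : ∃ μ, IsRelCoeff Y α.support b μ ∧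
      ∀ p q, ψ (Submodule.Quotient.mk (taylorRel Y p q)) =
        μ p q • ringMonomial Y (charVec (p.1 ∪ q.1) + degSub α b) := by
  choose ρ hρ using fun p q => mem_ringPiece.1 (hψ _ _ (taylorRel_isHomogeneous p q))
  set μ : {p : Finset V // p ∉ Y} → {p : Finset V // p ∉ Y} → ℂ :=
    fun p q => if b ⊆ p.1 ∪ q.1 then ρ p q else 0 with hμ
  have hval : ∀ p q, ψ (Submodule.Quotient.mk (taylorRel Y p q)) =
      μ p q • ringMonomial Y (charVec (p.1 ∪ q.1) + degSub α b) := by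
    intro p q
    rw [hρ, hμ]
    by_cases hb : b ⊆ p.1 ∪ q.1
    · simp only [if_pos hb]
    · rw [ringMonomial_of_not_nonneg Y (mt (charVec_add_degSub_nonneg hab).1 hb), smul_zero,
        smul_zero]
  have hzero : ∀ p q, ¬ b ⊆ p.1 ∪ q.1 → μ p q = 0 := fun p q hb => if_neg hb
  have hsmul : ∀ (p q) (W : Finset V), p.1 ⊆ W → q.1 ⊆ W →
      ψ (Submodule.Quotient.mk (sqfree (W \ (p.1 ∪ q.1)) • taylorRel Y p q)) =
        μ p q • ringMonomial Y (charVec W + degSub α b) := by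
    intro p q W hp hq
    rw [Submodule.Quotient.mk_smul, map_smul, hval, smul_comm]
    by_cases hb : b ⊆ p.1 ∪ q.1
    · rw [sqfree_smul_ringMonomial Y hab hb (Finset.union_subset hp hq)]
    · rw [hzero p q hb, zero_smul, zero_smul]
  refine ⟨μ, ⟨hzero, ?_, ?_⟩, hval⟩
  · intro p q r W hp hq hr hb hW
    have h0 := (ringMonomial_ne_zero_iff (X := Y) hab).2 ⟨hb, hW⟩
    have h1 := congrArg (fun x => ψ (Submodule.Quotient.mk x))
      (sqfree_smul_taylorRel_add hp hq hr)
    simp only [Submodule.Quotient.mk_add, map_add] at h1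
    rw [hsmul p q W hp hq, hsmul q r W hq hr, hsmul p r W hp hr, ← add_smul] at h1
    exact smul_left_injective ℂ h0 h1
  · intro p q hb hX
    have h1 : ψ (Submodule.Quotient.mk (sqfree (p.1 ∩ q.1) • taylorRel Y p q)) = 0 := by
      rw [(Submodule.Quotient.mk_eq_zero _).2 (sqfree_inter_smul_taylorRel_mem p q), map_zero]
    have hnn := (charVec_add_degSub_nonneg hab).2 hb
    obtain ⟨m, hm⟩ := exists_degOf_eq hnn
    rw [Submodule.Quotient.mk_smul, map_smul, hval, smul_comm, sqfree_eq_monomial,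
      monomial_smul_ringMonomial Y _ hnn, ← hm, ← degOf_add] at h1
    refine (smul_eq_zero.1 h1).resolve_right ?_
    rw [ringMonomial_degOf_eq_zero_iff, not_not]
    refine Y.down_closed hX fun i hi => ?_
    have h2 := Finsupp.support_add hi
    rw [support_sqfreeExp, support_of_degOf_eq hab hm] at h2
    simp only [trunc, Finset.mem_union, Finset.mem_inter, Finset.mem_sdiff] at h2 ⊢
    tauto

/-- The homomorphism `F → A_X`, `e_p ↦ ν(p) x^{p+𝐚-b}`. -/
def genHom (Y : Complex V) (α : V →₀ ℕ) (b : Finset V) (ν : {p : Finset V // p ∉ Y} → ℂ) :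
    ({p : Finset V // p ∉ Y} → MvPolynomial V ℂ) →ₗ[MvPolynomial V ℂ] srRing Y :=
  Fintype.linearCombination (MvPolynomial V ℂ) fun p =>
    ν p • ringMonomial Y (charVec p.1 + degSub α b)

lemma restrictHom_mk (u : ({p : Finset V // p ∉ Y} → MvPolynomial V ℂ) →ₗ[MvPolynomial V ℂ]
      srRing Y) (r : relations (srGen Y)) :
    restrictHom (srGen Y) u (Submodule.Quotient.mk r) = u r := rfl

lemma restrictHom_genHom_mem (hab : Disjoint α.support b) (ν : {p : Finset V // p ∉ Y} → ℂ) :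
    restrictHom (srGen Y) (genHom Y α b ν) ∈ relHomPiece Y (degSub α b) := by
  intro D r hr
  rw [restrictHom_mk, genHom, Fintype.linearCombination_apply]
  refine Submodule.sum_mem _ fun p _ => ?_
  by_cases hb : b ⊆ p.1
  · have hp := mem_polyPiece.1 (hr p)
    rw [(r.1 p).as_sum, Finset.sum_smul]
    refine Submodule.sum_mem _ fun m hm => ?_
    rw [monomial_eq_smul_one, smul_assoc, smul_comm _ (ν p),
      monomial_smul_ringMonomial Y _ ((charVec_add_degSub_nonneg hab).2 hb),
      hp m (mem_support_iff.1 hm), ← add_assoc, sub_add_cancel]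
    exact Submodule.smul_mem _ _ (Submodule.smul_mem _ _
      (mem_ringPiece.2 ⟨1, (one_smul _ _).symm⟩))
  · rw [ringMonomial_of_not_nonneg Y (mt (charVec_add_degSub_nonneg hab).1 hb), smul_zero,
      smul_zero]
    exact Submodule.zero_mem _

lemma restrictHom_taylorRel (u : ({p : Finset V // p ∉ Y} → MvPolynomial V ℂ)
      →ₗ[MvPolynomial V ℂ] srRing Y) (p q : {p : Finset V // p ∉ Y}) :
    restrictHom (srGen Y) u (Submodule.Quotient.mk (taylorRel Y p q)) =
      sqfree (q.1 \ p.1) • u (Pi.single p 1) - sqfree (p.1 \ q.1) • u (Pi.single q 1) := by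
  rw [restrictHom_mk, taylorRel, map_sub, ← map_smul, ← map_smul, ← Pi.single_smul',
    ← Pi.single_smul', smul_eq_mul, smul_eq_mul, mul_one, mul_one]

lemma restrictHom_genHom_taylorRel (hab : Disjoint α.support b)
    (ν : {p : Finset V // p ∉ Y} → ℂ) (p q : {p : Finset V // p ∉ Y}) :
    restrictHom (srGen Y) (genHom Y α b ν) (Submodule.Quotient.mk (taylorRel Y p q)) =
      ((if b ⊆ p.1 then ν p else 0) - (if b ⊆ q.1 then ν q else 0)) •
        ringMonomial Y (charVec (p.1 ∪ q.1) + degSub α b) := by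
  have h : ∀ p q : {p : Finset V // p ∉ Y},
      sqfree (q.1 \ p.1) • genHom Y α b ν (Pi.single p 1) =
        (if b ⊆ p.1 then ν p else 0) • ringMonomial Y (charVec (p.1 ∪ q.1) + degSub α b) := by
    intro p q
    rw [genHom, Fintype.linearCombination_apply_single, one_smul, smul_comm]
    by_cases hb : b ⊆ p.1
    · have h1 : q.1 \ p.1 = (p.1 ∪ q.1) \ p.1 := (Finset.union_sdiff_left _ _).symm
      rw [if_pos hb, h1, sqfree_smul_ringMonomial Y hab hb Finset.subset_union_left]
    · rw [if_neg hb, zero_smul, ringMonomial_of_not_nonneg Y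
        (mt (charVec_add_degSub_nonneg hab).1 hb), smul_zero, smul_zero]
  rw [restrictHom_taylorRel, h, h, Finset.union_comm q.1 p.1, sub_smul]

/-- The scalars of ψ may depend on p itself and not only on its truncation f. Subtracting the
restriction of e_p ↦ ν(p) x^{p+𝐚-b} with ν(p) = μ(p, f ∪ b) - κ(f) replaces μ(p, f ∪ b) by κ(f) when
b ⊆ p. When b is not contained in p nothing is subtracted, and the scalar is κ(f) already. -/
lemma exists_representsTwo (hab : Disjoint α.support b) {t : TTwo (srGen Y)}
    (ht : t ∈ tTwo Y (degSub α b)) : ∃ l, RepresentsTwo Y α b l t := by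
  classical
  obtain ⟨ψ, hψ, rfl⟩ := ht
  obtain ⟨μ, hμ, hval⟩ := exists_isRelCoeff hab hψ
  obtain ⟨κ, hκ⟩ := hμ.exists_normalizer hab
  set ν : {p : Finset V // p ∉ Y} → ℂ := fun p =>
    if h : trunc α.support b p.1 ∈ nSet Y α.support b then
      μ p (nonface ⟨_, h⟩) - κ ⟨_, h⟩ else 0 with hν
  have hνf : ∀ (p : {p : Finset V // p ∉ Y}) (f : nSet Y α.support b),
      trunc α.support b p.1 = f →
        μ p (nonface f) - (if b ⊆ p.1 then ν p else 0) = κ f := by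
    rintro p ⟨f, hf⟩ hpf
    dsimp only at hpf
    subst hpf
    by_cases hb : b ⊆ p.1
    · rw [if_pos hb, hν]
      simp only [dif_pos hf, sub_sub_cancel]
    · rw [if_neg hb, sub_zero, hκ p _ rfl hb]
  refine ⟨fun f g => κ f + μ (nonface f) (nonface g) - κ g,
    ψ - restrictHom (srGen Y) (genHom Y α b ν),
    Submodule.sub_mem _ hψ (restrictHom_genHom_mem hab ν), ?_, ?_⟩
  · change Submodule.Quotient.mk _ = Submodule.Quotient.mk _
    rw [Submodule.Quotient.eq, sub_sub_cancel_left]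
    exact Submodule.neg_mem _ ⟨_, rfl⟩
  · intro p q f g hf hg hX
    dsimp only
    rw [LinearMap.sub_apply, hval, restrictHom_genHom_taylorRel hab, ← sub_smul,
      hμ.eq_add_sub hf.symm hg.symm hX, ← hνf p f hf.symm, ← hνf q g hg.symm]
    congr 1
    ring

lemma trunc_union_eq {f g : Finset V} {p q : Finset V} (hf : f = trunc α.support b p)
    (hg : g = trunc α.support b q) : (p ∪ q ∪ α.support) \ b = f ∪ g := by
  rw [hf, hg, ← trunc_union]
  rfl

lemma RepresentsTwo.isCocycleTwo (hab : Disjoint α.support b)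
    {l : nSet Y α.support b → nSet Y α.support b → ℂ} {t : TTwo (srGen Y)}
    (h : RepresentsTwo Y α b l t) : IsCocycleTwo Y α.support b l := by
  obtain ⟨ψ, hψ, -, h⟩ := h
  obtain ⟨μ, hμ, hval⟩ := exists_isRelCoeff hab hψ
  refine hμ.isCocycleTwo hab fun p q f g hf hg hX hb => ?_
  have h1 := h p q f g hf.symm hg.symm hX
  rw [hval] at h1
  refine smul_left_injective ℂ ((ringMonomial_ne_zero_iff hab).2 ⟨hb, ?_⟩) h1
  rw [trunc_union_eq hf.symm hg.symm]
  exact hX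

lemma RepresentsTwo.eq_zero (hab : Disjoint α.support b) {t : TTwo (srGen Y)}
    (h : RepresentsTwo Y α b 0 t) : t = 0 := by
  obtain ⟨ψ, hψ, rfl, h⟩ := h
  suffices ψ = 0 by rw [this]; rfl
  refine relHom_ext fun p q => ?_
  rw [LinearMap.zero_apply]
  have hmem := hψ _ _ (taylorRel_isHomogeneous p q)
  by_cases h0 : ringMonomial Y (charVec (p.1 ∪ q.1) + degSub α b) = 0
  · exact eq_zero_of_mem_ringPiece hmem h0
  · have hX := ((ringMonomial_ne_zero_iff hab).1 h0).2
    have hX' : trunc α.support b p.1 ∪ trunc α.support b q.1 ∈ Y := by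
      rw [← trunc_union]
      exact hX
    rw [h p q
      ⟨_, trunc_mem_nSet hab p.2 (Y.down_closed hX' Finset.subset_union_left)⟩
      ⟨_, trunc_mem_nSet hab q.2 (Y.down_closed hX' Finset.subset_union_right)⟩ rfl rfl hX',
      Pi.zero_apply, Pi.zero_apply, zero_smul]

lemma RepresentsTwo.add {l l' : nSet Y α.support b → nSet Y α.support b → ℂ}
    {t t' : TTwo (srGen Y)} (h : RepresentsTwo Y α b l t) (h' : RepresentsTwo Y α b l' t') :
    RepresentsTwo Y α b (l + l') (t + t') := by
  obtain ⟨ψ, hψ, rfl, h⟩ := h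
  obtain ⟨ψ', hψ', rfl, h'⟩ := h'
  refine ⟨ψ + ψ', Submodule.add_mem _ hψ hψ', rfl, fun p q f g hf hg hX => ?_⟩
  rw [LinearMap.add_apply, h p q f g hf hg hX, h' p q f g hf hg hX, Pi.add_apply, Pi.add_apply,
    add_smul]

lemma RepresentsTwo.smul {l : nSet Y α.support b → nSet Y α.support b → ℂ}
    {t : TTwo (srGen Y)} (h : RepresentsTwo Y α b l t) (r : ℂ) :
    RepresentsTwo Y α b (r • l) (r • t) := by
  obtain ⟨ψ, hψ, rfl, h⟩ := h
  refine ⟨r • ψ, Submodule.smul_mem _ r hψ, rfl, fun p q f g hf hg hX => ?_⟩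
  rw [LinearMap.smul_apply, h p q f g hf hg hX, Pi.smul_apply, Pi.smul_apply, smul_assoc]

lemma RepresentsTwo.mem {l : nSet Y α.support b → nSet Y α.support b → ℂ}
    {t : TTwo (srGen Y)} (h : RepresentsTwo Y α b l t) : t ∈ tTwo Y (degSub α b) := by
  obtain ⟨ψ, hψ, rfl, -⟩ := h
  exact ⟨ψ, hψ, rfl⟩

/-- The map u on F need not be homogeneous, so ν(f) is taken to be one coefficient: that of x^{f+𝐚}
in a lift of u(e_{f ∪ b}). It is well defined in A_X because the support of x^{f+𝐚} is a face. -/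
lemma RepresentsTwo.isCoboundaryTwo (hab : Disjoint α.support b)
    {l : nSet Y α.support b → nSet Y α.support b → ℂ} (h : RepresentsTwo Y α b l 0) :
    IsCoboundaryTwo Y α.support b l := by
  have hcoc := h.isCocycleTwo hab
  obtain ⟨ψ, -, h0, h⟩ := h
  obtain ⟨u, rfl⟩ := (Submodule.Quotient.mk_eq_zero _).1 h0
  choose w hw using fun p : {p : Finset V // p ∉ Y} =>
    Ideal.Quotient.mk_surjective (u (Pi.single p 1))
  have hmk : ∀ p q, restrictHom (srGen Y) u (Submodule.Quotient.mk (taylorRel Y p q)) =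
      Ideal.Quotient.mk (srIdeal Y) (sqfree (q.1 \ p.1) * w p - sqfree (p.1 \ q.1) * w q) := by
    intro p q
    rw [restrictHom_taylorRel, ← hw, ← hw, map_sub, map_mul, map_mul]
    rfl
  refine ⟨fun f => coeff (sqfreeExp f.1 + α) (w (nonface f)), ?_, ?_⟩
  · rintro f ⟨-, b', hb', hX⟩
    have hff : f.1 ∪ f.1 ∈ Y := by rw [Finset.union_self]; exact f.2.1
    -- In the relation between f ∪ b and f ∪ b' the right-hand side is λ(f,f) = 0. The second term
    -- is divisible by x^{b \ b'}, which does not divide x^{f+𝐚}, so only ν(f) remains.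
    have h1 := h (nonface f) ⟨f.1 ∪ b', hX⟩ f f (trunc_union_self f.2).symm
      (trunc_union_subset f.2 hb'.1).symm hff
    have hl : l f f = 0 := by
      have h2 := hcoc.1 f f f (by rw [Finset.union_self]; exact hff)
      simpa using h2
    rw [hmk, hl, zero_smul, ← map_zero (Ideal.Quotient.mk (srIdeal Y))] at h1
    have h3 := coeff_eq_of_mk_eq h1 (support_mem_of_mem_nSet f)
    have h4 : (f.1 ∪ b') \ (nonface f).1 = ∅ :=
      Finset.sdiff_eq_empty_iff_subset.2 (Finset.union_subset_union_right hb'.1)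
    have h5 : sqfree (∅ : Finset V) = 1 := rfl
    rw [h4, h5, one_mul, coeff_sub, sqfree_eq_monomial, coeff_monomial_mul', if_neg, sub_zero,
      coeff_zero] at h3
    · exact h3
    · rw [sqfreeExp_le_iff]
      intro hle
      have h6 := subset_support_sqfreeExp_add hab f.2.2.2.1 hle
      refine hb'.2 fun i hi => ?_
      by_contra hib
      refine Finset.disjoint_left.1 h6 (Finset.mem_sdiff.2 ⟨Finset.mem_union_right _ hi, ?_⟩) hi
      intro hif
      exact Finset.disjoint_left.1 (Finset.disjoint_iff_inter_eq_empty.2 f.2.2.2.1)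
        ((Finset.mem_union.1 hif).resolve_right hib) hi
  · intro f g hX
    set k : nSet Y α.support b := ⟨f.1 ∪ g.1, union_mem_nSet f.2 g.2 hX⟩ with hk
    have h1 := h (nonface f) (nonface g) f g (trunc_union_self f.2).symm
      (trunc_union_self g.2).symm hX
    have h2 : (nonface f).1 ∪ (nonface g).1 = (nonface k).1 := by
      simp only [nonface, hk]
      exact (Finset.union_union_distrib_right _ _ _).symm
    have h3 : ringMonomial Y (charVec (nonface k).1 + degSub α b) = _ := ringMonomial_nonface k
    rw [hmk, h2, h3] at h1
    have h4 : Ideal.Quotient.mk (srIdeal Y) (sqfree ((nonface g).1 \ (nonface f).1) * w (nonface f) -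
        sqfree ((nonface f).1 \ (nonface g).1) * w (nonface g)) =
          Ideal.Quotient.mk (srIdeal Y) (l f g • monomial (sqfreeExp k.1 + α) 1) := h1
    -- Multiplication by x^{g \ f} shifts the coefficient at x^{f+𝐚} to the one at x^{(f ∪ g)+𝐚}.
    have key : ∀ f g k : nSet Y α.support b, k.1 = f.1 ∪ g.1 → ∀ v : MvPolynomial V ℂ,
        coeff (sqfreeExp k.1 + α) (sqfree ((nonface g).1 \ (nonface f).1) * v) =
          coeff (sqfreeExp f.1 + α) v := by
      intro f g k hk v
      have h5 : (nonface g).1 \ (nonface f).1 = g.1 \ f.1 := by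
        have h6 : ∀ i ∈ g.1, i ∉ b :=
          Finset.disjoint_left.1 (Finset.disjoint_iff_inter_eq_empty.2 g.2.2.2.1)
        ext i
        have := h6 i
        simp only [nonface, Finset.mem_sdiff, Finset.mem_union]
        tauto
      have h6 : sqfreeExp k.1 + α = sqfreeExp (g.1 \ f.1) + (sqfreeExp f.1 + α) := by
        rw [← add_assoc]
        congr 1
        ext i
        simp only [hk, Finsupp.add_apply, sqfreeExp_apply, Finset.mem_sdiff, Finset.mem_union]
        by_cases hs : i ∈ f.1 <;> by_cases ht : i ∈ g.1 <;> simp [hs, ht]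
      rw [h5, h6, sqfree_eq_monomial, coeff_monomial_mul, one_mul]
    have h7 := coeff_eq_of_mk_eq h4 (support_mem_of_mem_nSet k)
    rw [coeff_sub, key f g k rfl, key g f k (Finset.union_comm _ _), coeff_smul, coeff_monomial,
      if_pos rfl, smul_eq_mul, mul_one] at h7
    exact h7.symm

lemma IsCoboundaryTwo.represents (hab : Disjoint α.support b)
    {l : nSet Y α.support b → nSet Y α.support b → ℂ} (h : IsCoboundaryTwo Y α.support b l) :
    RepresentsTwo Y α b l 0 := by
  classical
  have hrep := homTwo_represents hab h.isCocycleTwo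
  suffices Submodule.Quotient.mk (homTwo hab h.isCocycleTwo) = (0 : TTwo (srGen Y)) by
    rwa [this] at hrep
  rw [Submodule.Quotient.mk_eq_zero]
  obtain ⟨ν, hν, hl⟩ := id h
  set ν' : {p : Finset V // p ∉ Y} → ℂ := fun p =>
    if h : trunc α.support b p.1 ∈ nSet Y α.support b then ν ⟨_, h⟩ else 0 with hν'
  -- If b is not contained in p, the image of e_p is 0 whatever ν' says; this is consistent because
  -- the truncation of p is then in Ñ, where ν vanishes.
  have hif : ∀ p : {p : Finset V // p ∉ Y}, ∀ hp : trunc α.support b p.1 ∈ nSet Y α.support b,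
      (if b ⊆ p.1 then ν' p else 0) = ν ⟨_, hp⟩ := by
    intro p hp
    by_cases hb : b ⊆ p.1
    · rw [if_pos hb, hν']
      simp only [dif_pos hp]
    · rw [if_neg hb, hν _ (trunc_mem_nTilde hab p.2 hp.1 hb)]
  refine ⟨genHom Y α b ν', relHom_ext fun p q => ?_⟩
  rw [restrictHom_genHom_taylorRel hab, homTwo_taylorRel]
  by_cases h0 : ringMonomial Y (charVec (p.1 ∪ q.1) + degSub α b) = 0
  · rw [h0, smul_zero, smul_zero]
  · have hX := ((ringMonomial_ne_zero_iff hab).1 h0).2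
    have hX' : trunc α.support b p.1 ∪ trunc α.support b q.1 ∈ Y := by
      rw [← trunc_union]
      exact hX
    have hp := trunc_mem_nSet hab p.2 (Y.down_closed hX' Finset.subset_union_left)
    have hq := trunc_mem_nSet hab q.2 (Y.down_closed hX' Finset.subset_union_right)
    rw [hif p hp, hif q hq, coeffTwo_of_mem l hp hq, hl _ _ hX']

end HomTwo

end

/-! ### Linear maps given by their graphs -/

section

/-- `Rel` is (the graph of) a linear map from a subspace of `L` onto `S`. -/
structure IsLinearParam {L T : Type*} [AddCommGroup L] [Module ℂ L] [AddCommGroup T] [Module ℂ T]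
    (S : Submodule ℂ T) (Rel : L → T → Prop) : Prop where
  add : ∀ {l l' t t'}, Rel l t → Rel l' t' → Rel (l + l') (t + t')
  smul : ∀ {l t} (r : ℂ), Rel l t → Rel (r • l) (r • t)
  mem : ∀ {l t}, Rel l t → t ∈ S
  surj : ∀ {t}, t ∈ S → ∃ l, Rel l t
  eq_zero : ∀ {t}, Rel 0 t → t = 0

namespace IsLinearParam

variable {L L' T T' : Type*} [AddCommGroup L] [Module ℂ L] [AddCommGroup T] [Module ℂ T]
  [AddCommGroup L'] [Module ℂ L'] [AddCommGroup T'] [Module ℂ T']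
  {S : Submodule ℂ T} {S' : Submodule ℂ T'} {Rel : L → T → Prop} {Rel' : L' → T' → Prop}

lemma sub (h : IsLinearParam S Rel) {l l' : L} {t t' : T} (h1 : Rel l t) (h2 : Rel l' t') :
    Rel (l - l') (t - t') := by
  have := h.add h1 (h.smul (-1) h2)
  rwa [neg_one_smul, neg_one_smul, ← sub_eq_add_neg, ← sub_eq_add_neg] at this

lemma unique (h : IsLinearParam S Rel) {l : L} {t t' : T} (h1 : Rel l t) (h2 : Rel l t') :
    t = t' :=
  sub_eq_zero.1 (h.eq_zero (by simpa using h.sub h1 h2))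

lemma eq_bot (h : IsLinearParam S Rel) (h0 : ∀ l t, Rel l t → Rel l 0) : S = ⊥ := by
  rw [Submodule.eq_bot_iff]
  intro t ht
  obtain ⟨l, hl⟩ := h.surj ht
  exact h.unique hl (h0 l t hl)

/-- Each of S and S' is a space of representing functions modulo those that represent 0, and s
matches these data. Injectivity of s is not needed, since the condition on kernels already makes the
kernel of s represent 0. -/
lemma exists_linearEquiv (h : IsLinearParam S Rel) (h' : IsLinearParam S' Rel') (s : L →ₗ[ℂ] L')
    (hs : Function.Surjective s) (dom : ∀ l, (∃ t, Rel l t) ↔ ∃ t', Rel' (s l) t')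
    (ker : ∀ l, Rel l 0 ↔ Rel' (s l) 0) :
    ∃ e : S ≃ₗ[ℂ] S', ∀ t : S, (∃ l, Rel l t) ∧ ∀ l, Rel l t ↔ Rel' (s l) (e t) := by
  have left : ∀ {l t t'}, Rel l t → Rel' (s l) t' → t = 0 → t' = 0 := by
    rintro l t t' h1 h2 rfl
    exact h'.unique h2 ((ker l).1 h1)
  have right : ∀ {l t t'}, Rel l t → Rel' (s l) t' → t' = 0 → t = 0 := by
    rintro l t t' h1 h2 rfl
    exact h.unique h1 ((ker l).2 h2)
  have total : ∀ t : S, ∃ t' : S', ∃ l, Rel l t ∧ Rel' (s l) t' := by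
    intro t
    obtain ⟨l, hl⟩ := h.surj t.2
    obtain ⟨t', ht'⟩ := (dom l).1 ⟨t, hl⟩
    exact ⟨⟨t', h'.mem ht'⟩, l, hl, ht'⟩
  choose F l hl hF using total
  have uniq : ∀ (t : S) {k : L} {t' : T'}, Rel k t → Rel' (s k) t' → (F t : T') = t' := by
    intro t k t' h1 h2
    refine sub_eq_zero.1 (left (h.sub (hl t) h1) ?_ (sub_self _))
    rw [map_sub]
    exact h'.sub (hF t) h2
  let φ : S →ₗ[ℂ] S' :=
    { toFun := F
      map_add' := fun t u => Subtype.ext (uniq _ (h.add (hl t) (hl u)) (by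
        rw [map_add]
        exact h'.add (hF t) (hF u)))
      map_smul' := fun r t => Subtype.ext (uniq _ (h.smul r (hl t)) (by
        rw [map_smul]
        exact h'.smul r (hF t))) }
  have hφ : Function.Bijective φ := by
    refine ⟨(injective_iff_map_eq_zero φ).2 fun t ht => ?_, fun t' => ?_⟩
    · exact Subtype.ext (right (hl t) (hF t) (congrArg Subtype.val ht))
    · obtain ⟨l', hl'⟩ := h'.surj t'.2
      obtain ⟨k, rfl⟩ := hs l'
      obtain ⟨t, ht⟩ := (dom k).2 ⟨_, hl'⟩
      exact ⟨⟨t, h.mem ht⟩, Subtype.ext (uniq ⟨t, h.mem ht⟩ ht hl')⟩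
  refine ⟨LinearEquiv.ofBijective φ hφ, fun t => ⟨⟨_, hl t⟩, fun k => ⟨fun hk => ?_, fun hk => ?_⟩⟩⟩
  · obtain ⟨t', ht'⟩ := (dom k).1 ⟨_, hk⟩
    have : (F t : T') = t' := uniq t hk ht'
    change Rel' (s k) (F t)
    rwa [this]
  · obtain ⟨u, hu⟩ := (dom k).2 ⟨_, hk⟩
    have h1 : F ⟨u, h.mem hu⟩ = F t := Subtype.ext (uniq ⟨u, h.mem hu⟩ hu hk)
    have h2 : (⟨u, h.mem hu⟩ : S) = t := hφ.1 h1
    rwa [← h2]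

end IsLinearParam

variable {V : Type*} [DecidableEq V]

/-! ### Transport of N, Ñ and the cocycle conditions to the link -/

section Link

variable {X : Complex V} {a b : Finset V}

lemma sdiff_mem_link_iff {f : Finset V} (hf : a ⊆ f) :
    f \ a ∈ X.link a ↔ f ∈ X := by
  constructor
  · rintro ⟨-, -, h⟩
    rwa [Finset.sdiff_union_of_subset hf] at h
  · intro h
    refine ⟨X.down_closed h Finset.sdiff_subset, Finset.sdiff_disjoint, ?_⟩
    rwa [Finset.sdiff_union_of_subset hf]

lemma sdiff_union_eq {f c : Finset V} (hc : Disjoint a c) : f \ a ∪ c = (f ∪ c) \ a := by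
  rw [Finset.union_sdiff_distrib, Finset.sdiff_eq_self_of_disjoint hc.symm]

lemma sdiff_mem_nSet_link (hab : Disjoint a b) {f : Finset V}
    (hf : f ∈ nSet X a b) : f \ a ∈ nSet (X.link a) ∅ b := by
  refine ⟨(sdiff_mem_link_iff hf.2.1).2 hf.1, Finset.empty_subset _, ?_, ?_⟩
  · rw [← Finset.disjoint_iff_inter_eq_empty] at *
    exact (Finset.disjoint_iff_inter_eq_empty.2 hf.2.2.1).mono_left Finset.sdiff_subset
  · rw [sdiff_union_eq hab, sdiff_mem_link_iff (hf.2.1.trans Finset.subset_union_left)]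
    exact hf.2.2.2

lemma union_mem_nSet_of_link (hab : Disjoint a b) {g : Finset V}
    (hg : g ∈ nSet (X.link a) ∅ b) : g ∪ a ∈ nSet X a b := by
  refine ⟨hg.1.2.2, Finset.subset_union_right, ?_, fun h => hg.2.2.2 ⟨?_, ?_, ?_⟩⟩
  · rw [Finset.union_inter_distrib_right, hg.2.2.1, Finset.disjoint_iff_inter_eq_empty.1 hab,
      Finset.union_empty]
  · exact X.down_closed h (Finset.union_subset_union_left Finset.subset_union_left)
  · exact Finset.disjoint_union_left.2 ⟨hg.1.2.1, hab.symm⟩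
  · rwa [Finset.union_right_comm]

/-- The bijection `f ↦ f ∖ a` from `N_{a-b}(X)` to `N_{∅-b}(lk(a))`. -/
def nSetEquiv (hab : Disjoint a b) : nSet X a b ≃ nSet (X.link a) ∅ b where
  toFun f := ⟨f.1 \ a, sdiff_mem_nSet_link hab f.2⟩
  invFun g := ⟨g.1 ∪ a, union_mem_nSet_of_link hab g.2⟩
  left_inv f := Subtype.ext (Finset.sdiff_union_of_subset f.2.2.1)
  right_inv g := Subtype.ext (Finset.union_sdiff_cancel_right g.2.1.2.1)

variable (hab : Disjoint a b)

lemma nSetEquiv_coe (f : nSet X a b) : (nSetEquiv hab f : Finset V) = f.1 \ a := rfl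

lemma nSetEquiv_mem_nTilde (f : nSet X a b) :
    f.1 ∈ nTilde X a b ↔ (nSetEquiv hab f).1 ∈ nTilde (X.link a) ∅ b := by
  have h : ∀ b' ⊂ b, (f.1 ∪ b' ∉ X ↔ f.1 \ a ∪ b' ∉ X.link a) := by
    intro b' hb'
    rw [sdiff_union_eq (hab.mono_right hb'.1),
      sdiff_mem_link_iff (f.2.2.1.trans Finset.subset_union_left)]
  constructor
  · rintro ⟨-, b', hb', h'⟩
    exact ⟨(nSetEquiv hab f).2, b', hb', (h b' hb').1 h'⟩
  · rintro ⟨-, b', hb', h'⟩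
    exact ⟨f.2, b', hb', (h b' hb').2 h'⟩

lemma nSetEquiv_union (f g : nSet X a b) :
    (nSetEquiv hab f).1 ∪ (nSetEquiv hab g).1 ∈ X.link a ↔ f.1 ∪ g.1 ∈ X := by
  rw [nSetEquiv_coe, nSetEquiv_coe, ← Finset.union_sdiff_distrib,
    sdiff_mem_link_iff (f.2.2.1.trans Finset.subset_union_left)]

lemma nSetEquiv_union_union (f g h : nSet X a b) :
    (nSetEquiv hab f).1 ∪ (nSetEquiv hab g).1 ∪ (nSetEquiv hab h).1 ∈ X.link a ↔
      f.1 ∪ g.1 ∪ h.1 ∈ X := by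
  rw [nSetEquiv_coe, nSetEquiv_coe, nSetEquiv_coe, ← Finset.union_sdiff_distrib,
    ← Finset.union_sdiff_distrib, sdiff_mem_link_iff
      (f.2.2.1.trans (Finset.subset_union_left.trans Finset.subset_union_left))]

lemma isCocycleOne_link_iff (l : nSet (X.link a) ∅ b → ℂ) :
    IsCocycleOne (X.link a) ∅ b l ↔
      IsCocycleOne X a b (fun f => l (nSetEquiv hab f)) := by
  simp only [IsCocycleOne, ← (nSetEquiv hab).forall_congr_right, nSetEquiv_union,
    ← nSetEquiv_mem_nTilde]

lemma isCoboundaryOne_link_iff (l : nSet (X.link a) ∅ b → ℂ) :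
    IsCoboundaryOne (X.link a) ∅ b l ↔
      IsCoboundaryOne X a b (fun f => l (nSetEquiv hab f)) := by
  simp only [IsCoboundaryOne, ← (nSetEquiv hab).forall_congr_right]

lemma isCocycleTwo_link_iff (l : nSet (X.link a) ∅ b → nSet (X.link a) ∅ b → ℂ) :
    IsCocycleTwo (X.link a) ∅ b l ↔
      IsCocycleTwo X a b (fun f g => l (nSetEquiv hab f) (nSetEquiv hab g)) := by
  simp only [IsCocycleTwo, ← (nSetEquiv hab).forall_congr_right, nSetEquiv_union,
    nSetEquiv_union_union, ← nSetEquiv_mem_nTilde]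

lemma isCoboundaryTwo_link_iff (l : nSet (X.link a) ∅ b → nSet (X.link a) ∅ b → ℂ) :
    IsCoboundaryTwo (X.link a) ∅ b l ↔
      IsCoboundaryTwo X a b (fun f g => l (nSetEquiv hab f) (nSetEquiv hab g)) := by
  simp only [IsCoboundaryTwo, ← (nSetEquiv hab).forall_congr_right, nSetEquiv_union,
    ← nSetEquiv_mem_nTilde]
  constructor
  · rintro ⟨ν, h1, h2⟩
    exact ⟨fun f => ν (nSetEquiv hab f), h1, h2⟩
  · rintro ⟨ν, h1, h2⟩
    exact ⟨fun f => ν ((nSetEquiv hab).symm f), by simpa using h1, by simpa using h2⟩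

end Link

section Param

variable [Fintype V] (X : Complex V) {α : V →₀ ℕ} {b : Finset V}

lemma isLinearParam_one (hab : Disjoint α.support b) :
    IsLinearParam (tOne X (degSub α b)) (RepresentsOne X α b) where
  add h h' := h.add h'
  smul r h := h.smul r
  mem h := h.mem
  surj ht := exists_representsOne hab ht
  eq_zero h := h.eq_zero hab

lemma isLinearParam_two (hab : Disjoint α.support b) :
    IsLinearParam (tTwo X (degSub α b)) (RepresentsTwo X α b) where
  add h h' := h.add h'
  smul r h := h.smul r
  mem h := h.mem
  surj ht := exists_representsTwo hab ht
  eq_zero h := h.eq_zero hab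

lemma exists_representsOne_iff (hab : Disjoint α.support b)
    (l : nSet X α.support b → ℂ) :
    (∃ t, RepresentsOne X α b l t) ↔ IsCocycleOne X α.support b l :=
  ⟨fun ⟨_, h⟩ => h.isCocycleOne hab, fun h => ⟨_, homOne_represents hab h⟩⟩

lemma representsOne_zero_iff (hab : Disjoint α.support b)
    (l : nSet X α.support b → ℂ) :
    RepresentsOne X α b l 0 ↔ IsCoboundaryOne X α.support b l :=
  ⟨fun h => h.isCoboundaryOne hab, fun h => h.represents hab⟩

lemma exists_representsTwo_iff (hab : Disjoint α.support b)
    (l : nSet X α.support b → nSet X α.support b → ℂ) :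
    (∃ t, RepresentsTwo X α b l t) ↔ IsCocycleTwo X α.support b l :=
  ⟨fun ⟨_, h⟩ => h.isCocycleTwo hab, fun h => ⟨_, homTwo_represents hab h⟩⟩

lemma representsTwo_zero_iff (hab : Disjoint α.support b)
    (l : nSet X α.support b → nSet X α.support b → ℂ) :
    RepresentsTwo X α b l 0 ↔ IsCoboundaryTwo X α.support b l :=
  ⟨fun h => h.isCoboundaryTwo hab, fun h => h.represents hab⟩

end Param

/-! ### Vanishing when a is not a face or b leaves the vertices of the link -/

section Vanishing

variable [Fintype V] {X : Complex V}

lemma tOne_eq_bot_of_ringMonomial {c : V → ℤ}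
    (h : ∀ U : Finset V, ringMonomial X (charVec U + c) = 0) : tOne X c = ⊥ := by
  rw [Submodule.eq_bot_iff]
  rintro _ ⟨φ, hφ, rfl⟩
  have : φ = 0 := ideal_hom_ext fun p =>
    eq_zero_of_mem_ringPiece (apply_idealGen_mem hφ p) (h p.1)
  rw [this, map_zero]

lemma tTwo_eq_bot_of_ringMonomial {c : V → ℤ}
    (h : ∀ U : Finset V, ringMonomial X (charVec U + c) = 0) : tTwo X c = ⊥ := by
  rw [Submodule.eq_bot_iff]
  rintro _ ⟨ψ, hψ, rfl⟩
  have : ψ = 0 := relHom_ext fun p q =>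
    eq_zero_of_mem_ringPiece (hψ _ _ (taylorRel_isHomogeneous p q)) (h _)
  rw [this, map_zero]

/-- A square-free degree raises each exponent by at most 1, so an entry ≤ -2 stays negative; and a
monomial without negative exponents keeps all of a in its support. -/
lemma ringMonomial_eq_zero_of_notMem {α β : V →₀ ℕ} (hαβ : Disjoint α.support β.support)
    (h : α.support ∉ X ∨ ∃ i, 2 ≤ β i) (U : Finset V) :
    ringMonomial X (charVec U + fun i => (α i : ℤ) - (β i : ℤ)) = 0 := by
  have hdisj : ∀ i, α i = 0 ∨ β i = 0 := by
    intro i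
    by_contra! hi
    exact Finset.disjoint_left.1 hαβ (Finsupp.mem_support_iff.2 hi.1)
      (Finsupp.mem_support_iff.2 hi.2)
  have hU : ∀ i, charVec U i = 0 ∨ charVec U i = 1 := by
    intro i
    by_cases hi : i ∈ U <;> simp [charVec, hi]
  by_cases h0 : 0 ≤ charVec U + fun i => (α i : ℤ) - (β i : ℤ)
  · obtain ⟨m, hm⟩ := exists_degOf_eq h0
    rcases h with h | ⟨i, hi⟩
    · rw [← hm, ringMonomial_degOf_eq_zero_iff]
      refine fun hX => h (X.down_closed hX fun i hi => ?_)
      have h1 := congrFun hm i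
      have h2 := hdisj i
      have h3 := hU i
      simp only [degOf, Pi.add_apply, Finsupp.mem_support_iff] at h1 hi ⊢
      omega
    · have h1 := h0 i
      have h2 := hdisj i
      have h3 := hU i
      simp only [Pi.zero_apply, Pi.add_apply] at h1
      omega
  · exact ringMonomial_of_not_nonneg X h0

variable {a b : Finset V}

/-- If b = {v}, then a lies in N and inside every member, so λ is constantly λ(a). Otherwise {v} is
a proper subset of b whose union with any f ⊇ a is a non-face, so N = Ñ. -/
lemma IsCocycleOne.isCoboundaryOne (ha : a ∈ X) (hab : Disjoint a b) {v : V} (hv : v ∈ b)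
    (hav : a ∪ {v} ∉ X) {l : nSet X a b → ℂ} (hl : IsCocycleOne X a b l) :
    IsCoboundaryOne X a b l := by
  by_cases hb : b.card = 1
  · obtain ⟨w, rfl⟩ := Finset.card_eq_one.1 hb
    obtain rfl := Finset.mem_singleton.1 hv
    have haN : a ∈ nSet X a {v} :=
      ⟨ha, subset_rfl, Finset.disjoint_iff_inter_eq_empty.1 hab, hav⟩
    refine ⟨l ⟨a, haN⟩, fun h => absurd hb h, fun f => hl.1 _ _ ?_⟩
    rw [Finset.union_eq_left.2 f.2.2.1]
    exact f.2.1
  · refine ⟨0, fun _ => rfl, fun f => hl.2 f ⟨f.2, {v}, ?_, fun h => hav (X.down_closed h ?_)⟩⟩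
    · refine Finset.ssubset_iff_subset_ne.2 ⟨Finset.singleton_subset_iff.2 hv, ?_⟩
      rintro rfl
      exact hb (Finset.card_singleton v)
    · exact Finset.union_subset_union_left f.2.2.1

/-- If b = {v}, contraction to the least face a gives ν(f) = λ(f, a). Otherwise N = Ñ and ν = 0
works. -/
lemma IsCocycleTwo.isCoboundaryTwo (ha : a ∈ X) (hab : Disjoint a b) {v : V} (hv : v ∈ b)
    (hav : a ∪ {v} ∉ X) {l : nSet X a b → nSet X a b → ℂ} (hl : IsCocycleTwo X a b l) :
    IsCoboundaryTwo X a b l := by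
  by_cases hb : b.card = 1
  · obtain ⟨w, rfl⟩ := Finset.card_eq_one.1 hb
    obtain rfl := Finset.mem_singleton.1 hv
    have haN : a ∈ nSet X a {v} :=
      ⟨ha, subset_rfl, Finset.disjoint_iff_inter_eq_empty.1 hab, hav⟩
    refine ⟨fun f => l f ⟨a, haN⟩, fun f hf => absurd hf (nTilde_eq_empty_of_card_eq_one hb _),
      fun f g hfg => ?_⟩
    rw [eq_sub_iff_add_eq]
    refine hl.1 f g ⟨a, haN⟩ ?_
    rwa [Finset.union_eq_left.2 (f.2.2.1.trans Finset.subset_union_left)]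
  · have hN : ∀ f : nSet X a b, f.1 ∈ nTilde X a b := by
      refine fun f => ⟨f.2, {v}, ?_, fun h => hav (X.down_closed h ?_)⟩
      · refine Finset.ssubset_iff_subset_ne.2 ⟨Finset.singleton_subset_iff.2 hv, ?_⟩
        rintro rfl
        exact hb (Finset.card_singleton v)
      · exact Finset.union_subset_union_left f.2.2.1
    exact ⟨fun _ => 0, fun _ _ => rfl, fun f g hfg => by rw [hl.2 f g (hN f) (hN g) hfg, sub_zero]⟩

lemma tOne_tTwo_eq_bot {α β : V →₀ ℕ} (hαβ : Disjoint α.support β.support)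
    (h : ¬ (α.support ∈ X ∧ (β.support : Set V) ⊆ (X.link α.support).vertices)) :
    tOne X (fun i => (α i : ℤ) - (β i : ℤ)) = ⊥ ∧
      tTwo X (fun i => (α i : ℤ) - (β i : ℤ)) = ⊥ := by
  by_cases h1 : α.support ∉ X ∨ ∃ i, 2 ≤ β i
  · exact ⟨tOne_eq_bot_of_ringMonomial (ringMonomial_eq_zero_of_notMem hαβ h1),
      tTwo_eq_bot_of_ringMonomial (ringMonomial_eq_zero_of_notMem hαβ h1)⟩
  · push Not at h1
    obtain ⟨ha, hβ⟩ := h1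
    obtain ⟨v, hv, hvX⟩ := Set.not_subset.1 fun h' => h ⟨ha, h'⟩
    have hv' : v ∈ β.support := hv
    have hav : α.support ∪ {v} ∉ X := fun hX => hvX
      ⟨X.down_closed hX Finset.subset_union_right,
        Finset.disjoint_singleton_left.2 fun hva => Finset.disjoint_left.1 hαβ hva hv',
        by rwa [Finset.union_comm]⟩
    -- All entries of β are now at most 1, so β is the characteristic vector of its support.
    have hc : (fun i => (α i : ℤ) - (β i : ℤ)) = degSub α β.support := by
      ext i
      have h2 := hβ i
      simp only [degSub, charVec, Finsupp.mem_support_iff]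
      split_ifs with h3 <;> omega
    rw [hc]
    exact ⟨(isLinearParam_one X hαβ).eq_bot fun l t ht => (representsOne_zero_iff X hαβ l).2
        ((ht.isCocycleOne hαβ).isCoboundaryOne ha hαβ hv' hav),
      (isLinearParam_two X hαβ).eq_bot fun l t ht => (representsTwo_zero_iff X hαβ l).2
        ((ht.isCocycleTwo hαβ).isCoboundaryTwo ha hαβ hv' hav)⟩

end Vanishing

/-! ### The isomorphisms between T^i of the link and of the complex -/

section Isomorphism

variable [Fintype V] {X : Complex V} {α : V →₀ ℕ} {b : Finset V}

lemma exists_tOne_link_equiv (hab : Disjoint α.support b) :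
    ∃ e : tOne (X.link α.support) (degSub 0 b) ≃ₗ[ℂ] tOne X (degSub α b),
      ∀ t : tOne (X.link α.support) (degSub 0 b),
        (∃ l, RepresentsOne (X.link α.support) 0 b l t) ∧
        ∀ l, RepresentsOne (X.link α.support) 0 b l t ↔
          RepresentsOne X α b (fun f => l (nSetEquiv hab f)) (e t) := by
  have h0 : Disjoint (0 : V →₀ ℕ).support b := Finset.disjoint_empty_left b
  refine (isLinearParam_one (X.link α.support) h0).exists_linearEquiv (isLinearParam_one X hab)
    (LinearMap.funLeft ℂ ℂ (nSetEquiv hab)) ?_ (fun l => ?_) (fun l => ?_)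
  · exact LinearMap.funLeft_surjective_of_injective _ _ _ (nSetEquiv hab).injective
  · rw [exists_representsOne_iff _ h0, exists_representsOne_iff X hab]
    exact isCocycleOne_link_iff hab l
  · rw [representsOne_zero_iff _ h0, representsOne_zero_iff X hab]
    exact isCoboundaryOne_link_iff hab l

lemma exists_tTwo_link_equiv (hab : Disjoint α.support b) :
    ∃ e : tTwo (X.link α.support) (degSub 0 b) ≃ₗ[ℂ] tTwo X (degSub α b),
      ∀ t : tTwo (X.link α.support) (degSub 0 b),
        (∃ l, RepresentsTwo (X.link α.support) 0 b l t) ∧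
        ∀ l, RepresentsTwo (X.link α.support) 0 b l t ↔
          RepresentsTwo X α b (fun f g => l (nSetEquiv hab f) (nSetEquiv hab g)) (e t) := by
  have h0 : Disjoint (0 : V →₀ ℕ).support b := Finset.disjoint_empty_left b
  let s : (nSet (X.link α.support) ∅ b → nSet (X.link α.support) ∅ b → ℂ) →ₗ[ℂ]
      (nSet X α.support b → nSet X α.support b → ℂ) :=
    { toFun := fun l f g => l (nSetEquiv hab f) (nSetEquiv hab g)
      map_add' := fun _ _ => rfl
      map_smul' := fun _ _ => rfl }
  refine (isLinearParam_two (X.link α.support) h0).exists_linearEquiv (isLinearParam_two X hab)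
    s (fun l => ?_) (fun l => ?_) (fun l => ?_)
  · refine ⟨fun f g => l ((nSetEquiv hab).symm f) ((nSetEquiv hab).symm g), ?_⟩
    ext f g
    simp [s]
  · rw [exists_representsTwo_iff _ h0, exists_representsTwo_iff X hab]
    exact isCocycleTwo_link_iff hab l
  · rw [representsTwo_zero_iff _ h0, representsTwo_zero_iff X hab]
    exact isCoboundaryTwo_link_iff hab l

end Isomorphism

end

end

end StanleyReisner

open StanleyReisner in
theorem proposition4p1 (n : ℕ) (X : StanleyReisner.Complex (Fin (n + 1)))
    (α : Fin (n + 1) →₀ ℕ) :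
    (∀ β : Fin (n + 1) →₀ ℕ, Disjoint α.support β.support →
      ¬ (α.support ∈ X ∧ (β.support : Set (Fin (n + 1))) ⊆ (X.link α.support).vertices) →
        tOne X (fun i => (α i : ℤ) - (β i : ℤ)) = ⊥ ∧
        tTwo X (fun i => (α i : ℤ) - (β i : ℤ)) = ⊥) ∧
    (∀ b : Finset (Fin (n + 1)), Disjoint α.support b →
      α.support ∈ X → (b : Set (Fin (n + 1))) ⊆ (X.link α.support).vertices →
        ∃ σ : nSet X α.support b ≃
            nSet (X.link α.support) ∅ b,
          (∀ f : nSet X α.support b, (σ f : Finset (Fin (n + 1))) = (f : Finset (Fin (n + 1))) \ α.support) ∧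
          (∀ f : nSet X α.support b, (f : Finset (Fin (n + 1))) ∈ nTilde X α.support b ↔
            (σ f : Finset (Fin (n + 1))) ∈ nTilde (X.link α.support) ∅ b) ∧
          (∃ e : tOne (X.link α.support) (degSub 0 b) ≃ₗ[ℂ] tOne X (degSub α b),
            ∀ t : tOne (X.link α.support) (degSub 0 b), (∃ l, RepresentsOne (X.link α.support) 0 b l t) ∧
              ∀ l, RepresentsOne (X.link α.support) 0 b l t ↔
                RepresentsOne X α b (fun f => l (σ f)) (e t)) ∧
          (∃ e : tTwo (X.link α.support) (degSub 0 b) ≃ₗ[ℂ] tTwo X (degSub α b),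
            ∀ t : tTwo (X.link α.support) (degSub 0 b), (∃ l, RepresentsTwo (X.link α.support) 0 b l t) ∧
              ∀ l, RepresentsTwo (X.link α.support) 0 b l t ↔
                RepresentsTwo X α b (fun f g => l (σ f) (σ g)) (e t))) := by
  refine ⟨fun β hαβ h => tOne_tTwo_eq_bot hαβ h, fun b hab _ _ => ?_⟩
  exact ⟨nSetEquiv hab, nSetEquiv_coe hab, nSetEquiv_mem_nTilde hab,
    exists_tOne_link_equiv hab, exists_tTwo_link_equiv hab⟩
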